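/- Let $n,k\ge 1$ and $N\ge 0$ be integers and $L=\lfloor N/n\rfloor$. Let $\mathbb C[X,A]$ be the polynomial ring in the entries of an $N\times N$ matrix $X=(X^i_j)$ and an $n\times N$ matrix $A=(A^a_i)$, and let $$\mathcal H_N=\{f\in\mathbb C[X,A] : f(hXh^{-1},Ah^{-1})=\det(h)^{-k}f(X,A)\ \text{ for all } h\in \mathrm{GL}_N(\mathbb C)\}.$$ Equip $\mathbb C[X,A]$, and hence $\mathcal H_N$, with the Hermitian inner product for which the monomials are orthogonal and $\langle x^m|x^m\rangle=m!:=\prod_v m_v!$ for every exponent vector $m$ (the one for which each coordinate $x_v$ is adjoint to $\partial/\partial x_v$ and $\langle 1|1\rangle=1$). Let $Y^i_j=\partial/\partial X^j_i$, $B^i_a=\partial/\partial A^a_i$, and let $(XY)^i_j=\sum_l X^i_lY^l_j$ be regarded as an $N\times N$ matrix of operators. For $1\le a,b\le n$ let $${}^{L}\widetilde T^a_b(u)=\Big[\delta^a_b+\sum_{s\ge0}u^{-s-1}\sum_{i,j=1}^N A^a_i\big((XY-(k+n)L)^s\big)^i_jB^j_b\Big]\prod_{j=1}^{L}\frac{u+(n+k)j}{u+k+(n+k)j},$$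 that is, $\big[\delta^a_b+A^a(u+(k+n)L-XY)^{-1}B_b\big]\prod_{j=1}^L\frac{u+(n+k)j}{u+k+(n+k)j}$ expanded at $u=\infty$; it is a power series in $u^{-1}$ whose coefficients are operators on $\mathcal H_N$. On $\mathcal H_{N+n}$ the same formula is used with $N+n$ and $L+1$ in place of $N$ and $L$, and gives ${}^{L+1}\widetilde T^a_b(u)$. Split $\mathbb C^{N+n}=\mathbb C^N\oplus\mathbb C^n$, let $\eta$ be an $n\times n$ matrix of further variables, and for $f\in\mathcal H_{N+n}$ let $f(X\oplus 0,(A,\eta))\in\mathbb C[X,A,\eta]$ be its restriction to pairs consisting of a block diagonal matrix $X\oplus 0$ and a framing $(A,\eta)$. Then there is a unique linear map $p_N:\mathcal H_{N+n}\to\mathcal H_N$ with $$f(X\oplus 0,(A,\eta))=\det(X)^k\det(\eta)^k\,(p_Nf)(X,A)\qquad\text{for all } f\in\mathcal H_{N+n};$$ there is a unique linear map $\sigma_N:\mathcal H_N\to\mathcal H_{N+n}$ with $p_N\circ\sigma_N=\mathrm{id}$ and image in $\ker(p_N)^\perp$; and for all $1\le a,b\le n$ (coefficientwise in $u^{-1}$)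 $$p_N\circ {}^{L+1}\widetilde T^a_b(u)={}^{L}\widetilde T^a_b(u)\circ p_N,\qquad \sigma_N\circ {}^{L}\widetilde T^a_b(u)={}^{L+1}\widetilde T^a_b(u)\circ\sigma_N .$$ -/

import Mathlib

open MvPolynomial

noncomputable section

namespace MatrixModel

/-- Index set of the coordinates on `End(ℂ^N) × Hom(ℂ^n, ℂ^N)`: `Sum.inl (i, j)` is `X^i_j`
and `Sum.inr (a, i)` is `A^a_i`. -/
abbrev Coord (N n : ℕ) : Type := (Fin N × Fin N) ⊕ (Fin n × Fin N)

/-- The polynomial ring `ℂ[X, A]`. -/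
abbrev Poly (N n : ℕ) : Type := MvPolynomial (Coord N n) ℂ

/-- Linear operators on `ℂ[X, A]`; multiplication is composition. -/
abbrev Op (N n : ℕ) : Type := Module.End ℂ (Poly N n)

/-- The matrix of coordinate functions `X^i_j`. -/
def coordX (N n : ℕ) : Matrix (Fin N) (Fin N) (Poly N n) :=
  Matrix.of fun i j => X (Sum.inl (i, j))

/-- The matrix of coordinate functions `A^a_i`. -/
def coordA (N n : ℕ) : Matrix (Fin n) (Fin N) (Poly N n) :=
  Matrix.of fun a i => X (Sum.inr (a, i))

/-- The substitution `f(X, A) ↦ f(h X h⁻¹, A h⁻¹)`. -/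
def gaugeAct {N n : ℕ} (h : GL (Fin N) ℂ) : Poly N n →ₐ[ℂ] Poly N n :=
  let P : Matrix (Fin N) (Fin N) (Poly N n) := (h : Matrix (Fin N) (Fin N) ℂ).map C
  let Q : Matrix (Fin N) (Fin N) (Poly N n) :=
    ((h⁻¹ : GL (Fin N) ℂ) : Matrix (Fin N) (Fin N) ℂ).map C
  aeval (Sum.elim
    (fun ij => (P * coordX N n * Q : Matrix (Fin N) (Fin N) (Poly N n)) ij.1 ij.2)
    (fun ai => (coordA N n * Q : Matrix (Fin n) (Fin N) (Poly N n)) ai.1 ai.2))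

/-- The Hilbert space `ℂ[X, A]^{GL_N, -k}` of polynomials on which `GL_N` acts through
`det ^ (-k)`. -/
def hilb (N n k : ℕ) : Submodule ℂ (Poly N n) where
  carrier := {f | ∀ h : GL (Fin N) ℂ,
    gaugeAct h f = ((h : Matrix (Fin N) (Fin N) ℂ).det ^ k)⁻¹ • f}
  add_mem' := by
    intro f g hf hg h
    rw [map_add, hf h, hg h, smul_add]
  zero_mem' := by
    intro h
    simp
  smul_mem' := by
    intro c f hf h
    rw [map_smul, hf h, smul_comm]

/-- `X^i_j` acting by multiplication. -/
def opX (N n : ℕ) : Matrix (Fin N) (Fin N) (Op N n) :=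
  Matrix.of fun i j => LinearMap.mulLeft ℂ (X (Sum.inl (i, j)))

/-- `Y^i_j = ∂/∂X^j_i`. -/
def opY (N n : ℕ) : Matrix (Fin N) (Fin N) (Op N n) :=
  Matrix.of fun i j => (pderiv (Sum.inl (j, i)) : Derivation ℂ (Poly N n) (Poly N n)).toLinearMap

/-- `A^a_i` acting by multiplication. -/
def opA (N n : ℕ) : Matrix (Fin n) (Fin N) (Op N n) :=
  Matrix.of fun a i => LinearMap.mulLeft ℂ (X (Sum.inr (a, i)))

/-- `B^i_a = ∂/∂A^a_i`. -/
def opB (N n : ℕ) : Matrix (Fin N) (Fin n) (Op N n) :=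
  Matrix.of fun i a => (pderiv (Sum.inr (a, i)) : Derivation ℂ (Poly N n) (Poly N n)).toLinearMap

/-- The operators `A^a (X Y - c)^s B_b`, the coefficients of
`A^a (u + c - X Y)⁻¹ B_b = ∑_s A^a (X Y - c)^s B_b u^{-s-1}`. -/
def mode (N n : ℕ) (c : ℂ) (s : ℕ) : Matrix (Fin n) (Fin n) (Op N n) :=
  opA N n * (opX N n * opY N n - c • (1 : Matrix (Fin N) (Fin N) (Op N n))) ^ s * opB N n

section Invariance

variable {N n : ℕ}

/-- Entrywise intertwining of two matrices of operators by one operator. -/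
def Rel {α β : Type} (G : Op N n) (M M' : Matrix α β (Op N n)) : Prop :=
  ∀ i j, G * M i j = M' i j * G

lemma Rel.mul {α β γ : Type} [Fintype β] {G : Op N n} {M M' : Matrix α β (Op N n)}
    {P P' : Matrix β γ (Op N n)} (h : Rel G M M') (h' : Rel G P P') :
    Rel G (M * P) (M' * P') := by
  intro i j
  rw [Matrix.mul_apply, Matrix.mul_apply, Finset.mul_sum, Finset.sum_mul]
  refine Finset.sum_congr rfl fun l _ => ?_
  rw [← mul_assoc, h, mul_assoc, h', mul_assoc]

lemma Rel.sub {α β : Type} {G : Op N n} {M M' P P' : Matrix α β (Op N n)}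
    (h : Rel G M M') (h' : Rel G P P') : Rel G (M - P) (M' - P') := by
  intro i j
  rw [Matrix.sub_apply, Matrix.sub_apply, mul_sub, sub_mul, h, h']

lemma Rel.smul_one {α : Type} [DecidableEq α] (G : Op N n) (c : ℂ) :
    Rel G (c • (1 : Matrix α α (Op N n))) (c • 1) := by
  intro i j
  by_cases h : i = j <;> simp [h]

lemma Rel.pow {α : Type} [Fintype α] [DecidableEq α] {G : Op N n} {M M' : Matrix α α (Op N n)}
    (h : Rel G M M') (s : ℕ) : Rel G (M ^ s) (M' ^ s) := by
  induction s with
  | zero =>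
    intro i j
    by_cases h : i = j <;> simp [h]
  | succ s ih =>
    rw [pow_succ, pow_succ]
    exact ih.mul h

/-- Complex matrices as matrices of scalar operators. -/
def scal (N n : ℕ) : Matrix (Fin N) (Fin N) ℂ →+* Matrix (Fin N) (Fin N) (Op N n) :=
  (algebraMap ℂ (Op N n)).mapMatrix

lemma pderiv_aeval {σ : Type} [Fintype σ] (F : σ → MvPolynomial σ ℂ) (v : σ)
    (f : MvPolynomial σ ℂ) :
    pderiv v (aeval F f) = ∑ w, pderiv v (F w) * aeval F (pderiv w f) := by
  classical
  induction f using MvPolynomial.induction_on with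
  | C a => simp
  | add p q hp hq => simp only [map_add, hp, hq, mul_add, Finset.sum_add_distrib]
  | mul_X p w hp =>
    simp only [map_mul, aeval_X, Derivation.leibniz, smul_eq_mul, hp, map_add, mul_add,
      Finset.sum_add_distrib, pderiv_X, Finset.mul_sum]
    congr 1
    · rw [Finset.sum_eq_single w]
      · simp [mul_comm]
      · intro b _ hb
        simp [Pi.single_eq_of_ne hb.symm]
      · simp
    · exact Finset.sum_congr rfl fun _ _ => by ring

lemma gaugeAct_X (h : GL (Fin N) ℂ) (i j : Fin N) :
    gaugeAct h (X (Sum.inl (i, j)) : Poly N n) =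
      ∑ q, ∑ p, C (h.1 i p * h⁻¹.1 q j) * X (Sum.inl (p, q)) := by
  simp only [gaugeAct, aeval_X, Sum.elim_inl, Matrix.mul_apply, Matrix.map_apply, coordX,
    Matrix.of_apply, Finset.sum_mul, C_mul]
  exact Finset.sum_congr rfl fun _ _ => Finset.sum_congr rfl fun _ _ => by ring

lemma gaugeAct_A (h : GL (Fin N) ℂ) (a : Fin n) (i : Fin N) :
    gaugeAct h (X (Sum.inr (a, i)) : Poly N n) =
      ∑ q, C (h⁻¹.1 q i) * X (Sum.inr (a, q)) := by
  simp only [gaugeAct, aeval_X, Sum.elim_inr, Matrix.mul_apply, Matrix.map_apply, coordA,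
    Matrix.of_apply]
  exact Finset.sum_congr rfl fun _ _ => by ring

lemma scal_apply (M : Matrix (Fin N) (Fin N) ℂ) (i j : Fin N) :
    scal N n M i j = algebraMap ℂ (Op N n) (M i j) := rfl

lemma rel_opX (h : GL (Fin N) ℂ) :
    Rel (gaugeAct h).toLinearMap (opX N n) (scal N n h.1 * opX N n * scal N n h⁻¹.1) := by
  intro i j
  refine LinearMap.ext fun f => ?_
  have h1 : ((gaugeAct h).toLinearMap * opX N n i j : Op N n) f =
      gaugeAct h (X (Sum.inl (i, j)) * f) := rfl
  rw [h1, map_mul, gaugeAct_X]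
  simp [Matrix.mul_apply, scal_apply, opX, Finset.sum_mul, Finset.mul_sum, Algebra.algebraMap_eq_smul_one,
    MvPolynomial.smul_eq_C_mul, mul_assoc, mul_left_comm]

lemma rel_opA (h : GL (Fin N) ℂ) :
    Rel (gaugeAct h).toLinearMap (opA N n) (opA N n * scal N n h⁻¹.1) := by
  intro a i
  refine LinearMap.ext fun f => ?_
  have h1 : ((gaugeAct h).toLinearMap * opA N n a i : Op N n) f =
      gaugeAct h (X (Sum.inr (a, i)) * f) := rfl
  rw [h1, map_mul, gaugeAct_A]
  simp [Matrix.mul_apply, scal_apply, opA, Finset.sum_mul, Algebra.algebraMap_eq_smul_one,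
    MvPolynomial.smul_eq_C_mul, mul_assoc, mul_left_comm]

lemma pderiv_gaugeAct (h : GL (Fin N) ℂ) (v : Coord N n) (f : Poly N n) :
    pderiv v (gaugeAct h f) =
      ∑ w, pderiv v (gaugeAct h (X w)) * gaugeAct h (pderiv w f) := by
  simp only [gaugeAct, pderiv_aeval, aeval_X]

lemma opY_gaugeAct (h : GL (Fin N) ℂ) (i j : Fin N) (f : Poly N n) :
    pderiv (Sum.inl (i, j)) (gaugeAct h f) =
      ∑ p, ∑ q, (h.1 p i * h⁻¹.1 j q) • gaugeAct h (pderiv (Sum.inl (p, q)) f) := by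
  classical
  rw [pderiv_gaugeAct, Fintype.sum_sum_type, Fintype.sum_prod_type, Fintype.sum_prod_type]
  have h1 : ∀ p q, pderiv (Sum.inl (i, j)) (gaugeAct h (X (Sum.inl (p, q)) : Poly N n)) =
      C (h.1 p i * h⁻¹.1 j q) := by
    intro p q
    rw [gaugeAct_X, map_sum, Finset.sum_eq_single j, map_sum, Finset.sum_eq_single i]
    · simp [Derivation.leibniz]
    · intro b _ hb
      simp [Derivation.leibniz, pderiv_X, hb]
    · simp
    · intro b _ hb
      rw [map_sum]
      refine Finset.sum_eq_zero fun c _ => ?_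
      simp [Derivation.leibniz, pderiv_X, hb]
    · simp
  have h2 : ∀ a q, pderiv (Sum.inl (i, j)) (gaugeAct h (X (Sum.inr (a, q)) : Poly N n)) = 0 := by
    intro a q
    rw [gaugeAct_A, map_sum]
    exact Finset.sum_eq_zero fun c _ => by simp [Derivation.leibniz, pderiv_X]
  simp only [h1, h2, zero_mul, Finset.sum_const_zero, add_zero, smul_eq_C_mul]

lemma opB_gaugeAct (h : GL (Fin N) ℂ) (a : Fin n) (i : Fin N) (f : Poly N n) :
    pderiv (Sum.inr (a, i)) (gaugeAct h f) =
      ∑ q, h⁻¹.1 i q • gaugeAct h (pderiv (Sum.inr (a, q)) f) := by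
  classical
  rw [pderiv_gaugeAct, Fintype.sum_sum_type, Fintype.sum_prod_type, Fintype.sum_prod_type]
  have h1 : ∀ p q, pderiv (Sum.inr (a, i)) (gaugeAct h (X (Sum.inl (p, q)) : Poly N n)) = 0 := by
    intro p q
    rw [gaugeAct_X, map_sum]
    refine Finset.sum_eq_zero fun b _ => ?_
    rw [map_sum]
    exact Finset.sum_eq_zero fun c _ => by simp [Derivation.leibniz, pderiv_X]
  have h2 : ∀ b q, pderiv (Sum.inr (a, i)) (gaugeAct h (X (Sum.inr (b, q)) : Poly N n)) =
      if b = a then C (h⁻¹.1 i q) else 0 := by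
    intro b q
    rw [gaugeAct_A, map_sum]
    split_ifs with hb
    · subst hb
      rw [Finset.sum_eq_single i]
      · simp [Derivation.leibniz]
      · intro c _ hc
        simp [Derivation.leibniz, pderiv_X, hc]
      · simp
    · exact Finset.sum_eq_zero fun c _ => by
        simp [Derivation.leibniz, pderiv_X, hb]
  simp only [h1, h2, zero_mul, Finset.sum_const_zero, zero_add, smul_eq_C_mul]
  rw [Finset.sum_eq_single a]
  · simp
  · intro b _ hb
    simp [hb]
  · simp

lemma scal_inv_mul (h : GL (Fin N) ℂ) : scal N n h⁻¹.1 * scal N n h.1 = 1 := by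
  rw [← map_mul, ← Units.val_mul, inv_mul_cancel, Units.val_one, map_one]

lemma scal_mul_inv (h : GL (Fin N) ℂ) : scal N n h.1 * scal N n h⁻¹.1 = 1 := by
  rw [← map_mul, ← Units.val_mul, mul_inv_cancel, Units.val_one, map_one]

/-- Right multiplication of all entries by one operator. -/
def rmul {α β : Type} (M : Matrix α β (Op N n)) (G : Op N n) : Matrix α β (Op N n) :=
  Matrix.of fun i j => M i j * G

/-- Left multiplication of all entries by one operator. -/
def lmul {α β : Type} (G : Op N n) (M : Matrix α β (Op N n)) : Matrix α β (Op N n) :=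
  Matrix.of fun i j => G * M i j

lemma mul_rmul {α β γ : Type} [Fintype β] (M : Matrix α β (Op N n)) (P : Matrix β γ (Op N n))
    (G : Op N n) : rmul (M * P) G = M * rmul P G := by
  refine Matrix.ext fun i j => ?_
  simp [rmul, Matrix.mul_apply, Finset.sum_mul, mul_assoc]

lemma rmul_mul_scal {α : Type} (M : Matrix α (Fin N) (Op N n)) (c : Matrix (Fin N) (Fin N) ℂ)
    (G : Op N n) : rmul (M * scal N n c) G = rmul M G * scal N n c := by
  refine Matrix.ext fun i j => ?_
  simp only [rmul, Matrix.mul_apply, Finset.sum_mul, mul_assoc, Matrix.of_apply, scal_apply]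
  exact Finset.sum_congr rfl fun l _ => by rw [Algebra.commutes]

lemma rel_opY (h : GL (Fin N) ℂ) :
    Rel (gaugeAct h).toLinearMap (opY N n) (scal N n h.1 * opY N n * scal N n h⁻¹.1) := by
  have key : rmul (opY N n) (gaugeAct h).toLinearMap =
      scal N n h⁻¹.1 * lmul (gaugeAct h).toLinearMap (opY N n) * scal N n h.1 := by
    refine Matrix.ext fun i j => ?_
    refine LinearMap.ext fun f => ?_
    have h1 : rmul (opY N n) (gaugeAct h).toLinearMap i j f =
        pderiv (Sum.inl (j, i)) (gaugeAct h f) := rfl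
    rw [h1, opY_gaugeAct]
    simp [Matrix.mul_apply, scal_apply, lmul, opY, Finset.smul_sum,
      Algebra.algebraMap_eq_smul_one, mul_smul]
  have main : lmul (gaugeAct h).toLinearMap (opY N n) =
      rmul (scal N n h.1 * opY N n * scal N n h⁻¹.1) (gaugeAct h).toLinearMap := by
    rw [rmul_mul_scal, mul_rmul, key, ← mul_assoc, ← mul_assoc, scal_mul_inv, one_mul,
      mul_assoc, scal_mul_inv, mul_one]
  intro i j
  exact congrFun (congrFun main i) j

lemma rel_opB (h : GL (Fin N) ℂ) :
    Rel (gaugeAct h).toLinearMap (opB N n) (scal N n h.1 * opB N n) := by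
  have key : rmul (opB N n) (gaugeAct h).toLinearMap =
      scal N n h⁻¹.1 * lmul (gaugeAct h).toLinearMap (opB N n) := by
    refine Matrix.ext fun i a => ?_
    refine LinearMap.ext fun f => ?_
    have h1 : rmul (opB N n) (gaugeAct h).toLinearMap i a f =
        pderiv (Sum.inr (a, i)) (gaugeAct h f) := rfl
    rw [h1, opB_gaugeAct]
    simp [Matrix.mul_apply, scal_apply, lmul, opB, Algebra.algebraMap_eq_smul_one]
  have main : lmul (gaugeAct h).toLinearMap (opB N n) =
      rmul (scal N n h.1 * opB N n) (gaugeAct h).toLinearMap := by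
    rw [mul_rmul, key, ← Matrix.mul_assoc, scal_mul_inv, Matrix.one_mul]
  intro i j
  exact congrFun (congrFun main i) j

lemma conj_pow_aux (h : GL (Fin N) ℂ) (M : Matrix (Fin N) (Fin N) (Op N n)) (s : ℕ) :
    (scal N n h.1 * M * scal N n h⁻¹.1) ^ s = scal N n h.1 * M ^ s * scal N n h⁻¹.1 := by
  induction s with
  | zero => rw [pow_zero, pow_zero, mul_one, scal_mul_inv]
  | succ s ih =>
    rw [pow_succ, ih, pow_succ]
    calc _ = scal N n h.1 * M ^ s * (scal N n h⁻¹.1 * scal N n h.1) * M * scal N n h⁻¹.1 := by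
          simp only [mul_assoc]
      _ = _ := by rw [scal_inv_mul, mul_one]; simp only [mul_assoc]

lemma mode_comm (h : GL (Fin N) ℂ) (c : ℂ) (s : ℕ) (a b : Fin n) :
    (gaugeAct h).toLinearMap * mode N n c s a b = mode N n c s a b * (gaugeAct h).toLinearMap := by
  have hXY := (((rel_opX (n := n) h).mul (rel_opY h)).sub
    (Rel.smul_one (gaugeAct h).toLinearMap c)).pow s
  have hall := ((rel_opA (n := n) h).mul hXY).mul (rel_opB h)
  have e : scal N n h.1 * opX N n * scal N n h⁻¹.1 * (scal N n h.1 * opY N n * scal N n h⁻¹.1) -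
      c • (1 : Matrix (Fin N) (Fin N) (Op N n)) =
      scal N n h.1 * (opX N n * opY N n - c • (1 : Matrix (Fin N) (Fin N) (Op N n))) *
        scal N n h⁻¹.1 := by
    rw [mul_sub, sub_mul, mul_smul_comm, smul_mul_assoc, mul_one, scal_mul_inv]
    congr 1
    calc _ = scal N n h.1 * opX N n * (scal N n h⁻¹.1 * scal N n h.1) * opY N n *
          scal N n h⁻¹.1 := by simp only [mul_assoc]
      _ = _ := by rw [scal_inv_mul, mul_one]; simp only [mul_assoc]
  rw [e, conj_pow_aux] at hall
  have e2 : opA N n * scal N n h⁻¹.1 *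
      (scal N n h.1 * (opX N n * opY N n - c • (1 : Matrix (Fin N) (Fin N) (Op N n))) ^ s *
        scal N n h⁻¹.1) * (scal N n h.1 * opB N n) = mode N n c s := by
    have e3 : opA N n * scal N n h⁻¹.1 *
      (scal N n h.1 * (opX N n * opY N n - c • (1 : Matrix (Fin N) (Fin N) (Op N n))) ^ s *
        scal N n h⁻¹.1) * (scal N n h.1 * opB N n) =
      opA N n * ((scal N n h⁻¹.1 * scal N n h.1) *
        (opX N n * opY N n - c • (1 : Matrix (Fin N) (Fin N) (Op N n))) ^ s *
        (scal N n h⁻¹.1 * scal N n h.1)) * opB N n := by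
      simp only [Matrix.mul_assoc]
    rw [e3, scal_inv_mul, one_mul, mul_one, mode]
  rw [e2] at hall
  exact hall a b

end Invariance

/-- The operators `A^a (X Y - c)^s B_b` commute with the gauge group, so they preserve the
Hilbert space. -/
lemma mode_mem {N n k : ℕ} (c : ℂ) (s : ℕ) (a b : Fin n) :
    ∀ f ∈ hilb N n k, mode N n c s a b f ∈ hilb N n k := by
  intro f hf h
  have h1 : gaugeAct h (mode N n c s a b f) = mode N n c s a b (gaugeAct h f) :=
    LinearMap.congr_fun (mode_comm h c s a b) f
  rw [h1, hf h, map_smul]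

/-- `A^a (X Y - c)^s B_b` as an operator on the Hilbert space. -/
def hilbMode (N n k : ℕ) (c : ℂ) (s : ℕ) (a b : Fin n) : Module.End ℂ (hilb N n k) :=
  (mode N n c s a b).restrict (mode_mem c s a b)

/-- The series `δ^a_b + A^a (u + (k + n) L - X Y)⁻¹ B_b` with `L = ⌊N / n⌋`, expanded at
`u = ∞`; the power series variable stands for `u⁻¹`. -/
def shiftedT (N n k : ℕ) (a b : Fin n) : PowerSeries (Module.End ℂ (hilb N n k)) :=
  PowerSeries.C (if a = b then 1 else 0) +
    PowerSeries.X * PowerSeries.mk fun s =>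
      hilbMode N n k (((k + n) * (N / n) : ℕ) : ℂ) s a b

/-- The expansion at `u = ∞` of `∏_{j=1}^{L} (u + (n + k) j) / (u + k + (n + k) j)`; the power
series variable stands for `u⁻¹`. -/
def normFactor (n k L : ℕ) : PowerSeries ℂ :=
  ∏ j ∈ Finset.Icc 1 L,
    (1 + PowerSeries.C (((n + k) * j : ℕ) : ℂ) * PowerSeries.X) *
      (1 + PowerSeries.C ((k + (n + k) * j : ℕ) : ℂ) * PowerSeries.X)⁻¹

/-- The series `T̃^a_b(u)` of operators on the Hilbert space, in the variable `u⁻¹`. -/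
def tildeT (N n k : ℕ) (a b : Fin n) : PowerSeries (Module.End ℂ (hilb N n k)) :=
  shiftedT N n k a b *
    PowerSeries.map (algebraMap ℂ (Module.End ℂ (hilb N n k))) (normFactor n k (N / n))

/-- The Hermitian inner product `⟨w | v⟩` of the harmonic oscillator Fock space: the monomials
`x^m` are orthogonal, with `⟨x^m | x^m⟩ = m!`; it is antilinear in `w`. -/
def fockInner {N n : ℕ} (w v : Poly N n) : ℂ :=
  ∑ m ∈ v.support, starRingEnd ℂ (w.coeff m) * v.coeff m *
    ((m.prod fun _ e => e.factorial : ℕ) : ℂ)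

/-- Polynomials in `X ∈ End(ℂ^N)`, `A ∈ Hom(ℂ^N, ℂ^n)` and `η ∈ Hom(ℂ^n, ℂ^n)`;
`Sum.inr (a, l)` is `η^a_{N+l}`. -/
abbrev AuxPoly (N n : ℕ) : Type := MvPolynomial (Coord N n ⊕ (Fin n × Fin n)) ℂ

/-- The inclusion `ℂ[X, A] → ℂ[X, A, η]`. -/
def auxIncl (N n : ℕ) : Poly N n →ₐ[ℂ] AuxPoly N n := rename Sum.inl

/-- Restriction of functions along `(X, A, η) ↦ (X ⊕ 0, (A, η))`, where
`ℂ^{N+n} = ℂ^N ⊕ ℂ^n`. -/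
def auxRestrict (N n : ℕ) : Poly (N + n) n →ₐ[ℂ] AuxPoly N n :=
  aeval (Sum.elim
    (fun ij => Fin.addCases
      (fun i => Fin.addCases (fun j => X (Sum.inl (Sum.inl (i, j)))) (fun _ => 0) ij.2)
      (fun _ => 0) ij.1)
    (fun ai => Fin.addCases
      (fun i => X (Sum.inl (Sum.inr (ai.1, i)))) (fun l => X (Sum.inr (ai.1, l))) ai.2))

/-- `det X` in `ℂ[X, A, η]`. -/
def detX (N n : ℕ) : AuxPoly N n :=
  (Matrix.of fun i j : Fin N => (X (Sum.inl (Sum.inl (i, j))) : AuxPoly N n)).det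

/-- `det η` in `ℂ[X, A, η]`. -/
def detEta (N n : ℕ) : AuxPoly N n :=
  (Matrix.of fun a l : Fin n => (X (Sum.inr (a, l)) : AuxPoly N n)).det

/-- `p` is `det(X)^{-k} det(η)^{-k}` times the restriction map. -/
def IsTransitionMap (N n k : ℕ) (p : hilb (N + n) n k →ₗ[ℂ] hilb N n k) : Prop :=
  ∀ f : hilb (N + n) n k,
    auxRestrict N n f = detX N n ^ k * detEta N n ^ k * auxIncl N n (p f)

/-- `σ` is the inverse of `p` restricted to the orthogonal complement of `ker p`. -/
def IsHermitianSection {N n k : ℕ} (p : hilb (N + n) n k →ₗ[ℂ] hilb N n k)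
    (σ : hilb N n k →ₗ[ℂ] hilb (N + n) n k) : Prop :=
  p ∘ₗ σ = LinearMap.id ∧
    ∀ (v : hilb N n k) (w : hilb (N + n) n k), p w = 0 → fockInner (w : Poly (N + n) n) (σ v) = 0

end MatrixModel

end

/-!
Covariance of `f` under `GL_N(ℂ)` is a polynomial identity, hence holds over every commutative
algebra: `f(H X, A) det(H)^k = f(X H, A H)` for all square `H`. For `f` of size `N + n`, let `g` be
its restriction to the slice of pairs `([X 0; A 0], (0, 1))`. If `P` has `N` columns and `Q` has
`N` rows, the covariance with `H` the matrix with blocks `Q` and `A` reads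
`f(P Q, A) = det(Q; A)^k g(Q P, A P)`. On block diagonal pairs this is the defining property of the
transition map, so `p_N f = g`.

Over the dual numbers the covariance becomes infinitesimal. Restricted to the slice, it determines
the derivatives transverse to the slice, and so relates the operators
`t_s = A^a (XY - c)^s B_b` of size `N + n` to the operators `t'_s` of size `N` with parameter `c'`,
where `c = c' + k + n`, by `t_{s+1} + c t_s = t'_{s+1} + (c + k) t'_s`. The ratio of their
generating series is the one factor by which the normalizing products for `L + 1` and `L` differ.

Conversely `g` determines the polynomial `det(Q; A)^k g(Q P, A P)`, which is `GL_N`-invariant in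
`(P, Q)` and hence, by the first fundamental theorem of invariant theory, of the form `f(P Q, A)`.
The latter is proved for the Fock product, under which `∂/∂P ∂/∂Q` is adjoint to multiplication by
`P Q`: a Capelli identity shows that an invariant orthogonal to the polynomials in `P Q` vanishes.
Choosing `f` orthogonal to the ideal of the matrices of rank at most `N` makes it covariant and
orthogonal to `ker p_N`. The modes `(a, b)` and `(b, a)` are adjoint, so `(ker p_N)ᗮ` is
stable under all of them, and the intertwining property passes from `p_N` to its section.
-/

noncomputable section

namespace MatrixModel

/-- Evaluation of a polynomial in `(X, A)` at a pair of matrices over a commutative algebra. -/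
def evalAt {N n : ℕ} {R : Type*} [CommRing R] [Algebra ℂ R] (X₀ : Matrix (Fin N) (Fin N) R)
    (A₀ : Matrix (Fin n) (Fin N) R) : Poly N n →ₐ[ℂ] R :=
  aeval (Sum.elim (fun ij => X₀ ij.1 ij.2) (fun ai => A₀ ai.1 ai.2))

section Evaluation

variable {N n k : ℕ} {R S : Type*} [CommRing R] [Algebra ℂ R] [CommRing S] [Algebra ℂ S]

@[simp]
lemma evalAt_X_inl (X₀ : Matrix (Fin N) (Fin N) R) (A₀ : Matrix (Fin n) (Fin N) R)
    (i j : Fin N) : evalAt X₀ A₀ (X (Sum.inl (i, j))) = X₀ i j := by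
  simp [evalAt]

@[simp]
lemma evalAt_X_inr (X₀ : Matrix (Fin N) (Fin N) R) (A₀ : Matrix (Fin n) (Fin N) R)
    (a : Fin n) (i : Fin N) : evalAt X₀ A₀ (X (Sum.inr (a, i))) = A₀ a i := by
  simp [evalAt]

lemma algHom_evalAt (φ : R →ₐ[ℂ] S) (X₀ : Matrix (Fin N) (Fin N) R)
    (A₀ : Matrix (Fin n) (Fin N) R) (f : Poly N n) :
    φ (evalAt X₀ A₀ f) = evalAt (X₀.map φ) (A₀.map φ) f := by
  have : φ.comp (evalAt X₀ A₀) = evalAt (X₀.map φ) (A₀.map φ) := by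
    ext (⟨i, j⟩ | ⟨a, i⟩) <;> simp
  rw [← this, AlgHom.comp_apply]

lemma matrix_mul_map {l m o : Type*} [Fintype m] (φ : R →ₐ[ℂ] S) (P : Matrix l m R)
    (Q : Matrix m o R) : (P * Q).map φ = P.map φ * Q.map φ :=
  Matrix.map_mul (f := (φ : R →+* S))

lemma matrix_map_algebraMap_map {l m : Type*} (φ : R →ₐ[ℂ] S) (h : Matrix l m ℂ) :
    (h.map (algebraMap ℂ R)).map φ = h.map (algebraMap ℂ S) := by
  ext i j
  simp

lemma coordX_map_evalAt (X₀ : Matrix (Fin N) (Fin N) R) (A₀ : Matrix (Fin n) (Fin N) R) :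
    (coordX N n).map (evalAt X₀ A₀) = X₀ := by
  ext i j
  simp [coordX]

lemma coordA_map_evalAt (X₀ : Matrix (Fin N) (Fin N) R) (A₀ : Matrix (Fin n) (Fin N) R) :
    (coordA N n).map (evalAt X₀ A₀) = A₀ := by
  ext i j
  simp [coordA]

lemma evalAt_coord (f : Poly N n) : evalAt (coordX N n) (coordA N n) f = f := by
  have : evalAt (coordX N n) (coordA N n) = AlgHom.id ℂ (Poly N n) := by
    ext1 (⟨i, j⟩ | ⟨a, i⟩) <;> simp [coordX, coordA]
  rw [this, AlgHom.id_apply]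

lemma evalAt_gaugeAct (h : GL (Fin N) ℂ) (X₀ : Matrix (Fin N) (Fin N) R)
    (A₀ : Matrix (Fin n) (Fin N) R) (f : Poly N n) :
    evalAt X₀ A₀ (gaugeAct h f) =
      evalAt (h.1.map (algebraMap ℂ R) * X₀ * h⁻¹.1.map (algebraMap ℂ R))
        (A₀ * h⁻¹.1.map (algebraMap ℂ R)) f := by
  have : gaugeAct h f = evalAt
      (h.1.map (algebraMap ℂ (Poly N n)) * coordX N n * h⁻¹.1.map (algebraMap ℂ (Poly N n)))
      (coordA N n * h⁻¹.1.map (algebraMap ℂ (Poly N n))) f := rfl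
  rw [this, algHom_evalAt]
  simp only [matrix_mul_map, coordX_map_evalAt, coordA_map_evalAt, matrix_map_algebraMap_map]

lemma evalAt_mul_det_pow_of_isUnit {f : Poly N n} (hf : f ∈ hilb N n k) (h : GL (Fin N) ℂ)
    (X₀ : Matrix (Fin N) (Fin N) ℂ) (A₀ : Matrix (Fin n) (Fin N) ℂ) :
    evalAt (h.1 * X₀) A₀ f * h.1.det ^ k = evalAt (X₀ * h.1) (A₀ * h.1) f := by
  have hmap : ∀ P : Matrix (Fin N) (Fin N) ℂ, P.map (algebraMap ℂ ℂ) = P := fun P => rfl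
  have hinv : h.1 * h⁻¹.1 = 1 := by rw [← Units.val_mul, mul_inv_cancel, Units.val_one]
  have hdet : h.1.det ^ k ≠ 0 :=
    pow_ne_zero _ ((Matrix.isUnit_iff_isUnit_det _).mp h.isUnit).ne_zero
  have key := congrArg (evalAt (X₀ * h.1) (A₀ * h.1)) (hf h)
  rw [evalAt_gaugeAct, hmap, hmap, ← Matrix.mul_assoc, Matrix.mul_assoc _ h.1, hinv,
    Matrix.mul_one, Matrix.mul_assoc _ h.1, hinv, Matrix.mul_one, map_smul, smul_eq_mul] at key
  rw [key, mul_comm, mul_inv_cancel_left₀ hdet]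

lemma evalAt_mul_det_pow_complex {f : Poly N n} (hf : f ∈ hilb N n k)
    (H X₀ : Matrix (Fin N) (Fin N) ℂ) (A₀ : Matrix (Fin n) (Fin N) ℂ) :
    evalAt (H * X₀) A₀ f * H.det ^ k = evalAt (X₀ * H) (A₀ * H) f := by
  let σ := Fin N × Fin N
  let U : Matrix (Fin N) (Fin N) (MvPolynomial σ ℂ) := Matrix.mvPolynomialX (Fin N) (Fin N) ℂ
  let V : Matrix (Fin N) (Fin N) (MvPolynomial σ ℂ) := X₀.map (algebraMap ℂ _)
  let W : Matrix (Fin n) (Fin N) (MvPolynomial σ ℂ) := A₀.map (algebraMap ℂ _)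
  let φ (G : Matrix (Fin N) (Fin N) ℂ) : MvPolynomial σ ℂ →ₐ[ℂ] ℂ := aeval fun ij => G ij.1 ij.2
  have hU : ∀ G, U.map (φ G) = G := Matrix.mvPolynomialX_mapMatrix_aeval ℂ
  have hV : ∀ G, V.map (φ G) = X₀ := fun G => matrix_map_algebraMap_map (φ G) X₀
  have hW : ∀ G, W.map (φ G) = A₀ := fun G => matrix_map_algebraMap_map (φ G) A₀
  have hp : ∀ G, φ G (evalAt (U * V) W f * U.det ^ k) = evalAt (G * X₀) A₀ f * G.det ^ k :=
    fun G => by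
      simp only [map_mul, map_pow, algHom_evalAt, matrix_mul_map, AlgHom.map_det,
        AlgHom.mapMatrix_apply, hU, hV, hW]
  have hq : ∀ G, φ G (evalAt (V * U) (W * U) f) = evalAt (X₀ * G) (A₀ * G) f := fun G => by
    simp only [algHom_evalAt, matrix_mul_map, hU, hV, hW]
  have generic : evalAt (U * V) W f * U.det ^ k = evalAt (V * U) (W * U) f :=
    eq_of_eval_eq_on_gl fun g =>
      (hp g.1).trans ((evalAt_mul_det_pow_of_isUnit hf g X₀ A₀).trans (hq g.1).symm)
  rw [← hp, generic, hq]

/-- Over `ℂ` the identity is polynomial in the entries of the matrices, so it descends to every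
commutative algebra. -/
theorem evalAt_mul_det_pow {f : Poly N n} (hf : f ∈ hilb N n k)
    (H X₀ : Matrix (Fin N) (Fin N) R) (A₀ : Matrix (Fin n) (Fin N) R) :
    evalAt (H * X₀) A₀ f * H.det ^ k = evalAt (X₀ * H) (A₀ * H) f := by
  let σ := (Fin N × Fin N) ⊕ Coord N n
  let U : Matrix (Fin N) (Fin N) (MvPolynomial σ ℂ) := Matrix.of fun i j => X (Sum.inl (i, j))
  let V : Matrix (Fin N) (Fin N) (MvPolynomial σ ℂ) :=
    Matrix.of fun i j => X (Sum.inr (Sum.inl (i, j)))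
  let W : Matrix (Fin n) (Fin N) (MvPolynomial σ ℂ) :=
    Matrix.of fun a i => X (Sum.inr (Sum.inr (a, i)))
  have generic : evalAt (U * V) W f * U.det ^ k = evalAt (V * U) (W * U) f := by
    refine MvPolynomial.funext fun x => ?_
    change aeval x _ = aeval x _
    simp only [map_mul, map_pow, algHom_evalAt, matrix_mul_map, AlgHom.map_det,
      AlgHom.mapMatrix_apply]
    exact evalAt_mul_det_pow_complex hf _ _ _
  let φ : MvPolynomial σ ℂ →ₐ[ℂ] R := aeval (Sum.elim (fun ij => H ij.1 ij.2)
    (Sum.elim (fun ij => X₀ ij.1 ij.2) (fun ai => A₀ ai.1 ai.2)))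
  have hU : U.map φ = H := by ext; simp [U, φ]
  have hV : V.map φ = X₀ := by ext; simp [V, φ]
  have hW : W.map φ = A₀ := by ext; simp [W, φ]
  have := congrArg φ generic
  simpa only [map_mul, map_pow, algHom_evalAt, matrix_mul_map, AlgHom.map_det,
    AlgHom.mapMatrix_apply, hU, hV, hW] using this

end Evaluation

section Blocks

variable {N n m l : ℕ} {R S : Type*}

/-- The matrix with rows those of `Q` followed by those of `A`. -/
def stack (Q : Matrix (Fin N) (Fin m) R) (A : Matrix (Fin n) (Fin m) R) :
    Matrix (Fin (N + n)) (Fin m) R :=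
  (Matrix.fromRows Q A).submatrix finSumFinEquiv.symm id

@[simp]
lemma stack_castAdd (Q : Matrix (Fin N) (Fin m) R) (A : Matrix (Fin n) (Fin m) R) (i : Fin N)
    (j : Fin m) : stack Q A (Fin.castAdd n i) j = Q i j := by
  simp [stack]

@[simp]
lemma stack_natAdd (Q : Matrix (Fin N) (Fin m) R) (A : Matrix (Fin n) (Fin m) R) (a : Fin n)
    (j : Fin m) : stack Q A (Fin.natAdd N a) j = A a j := by
  simp [stack]

lemma stack_map (φ : R → S) (Q : Matrix (Fin N) (Fin m) R) (A : Matrix (Fin n) (Fin m) R) :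
    (stack Q A).map φ = stack (Q.map φ) (A.map φ) := by
  ext i j
  refine Fin.addCases (fun i => ?_) (fun a => ?_) i <;> simp

variable [CommRing R] [CommRing S]

/-- The projection `R^(N+n) = R^N ⊕ R^n → R^N` as a matrix. -/
def topProj (N n : ℕ) (R : Type*) [CommRing R] : Matrix (Fin N) (Fin (N + n)) R :=
  (1 : Matrix (Fin (N + n)) (Fin (N + n)) R).submatrix (Fin.castAdd n) id

/-- The projection `R^(N+n) = R^N ⊕ R^n → R^n` as a matrix. -/
def bottomProj (N n : ℕ) (R : Type*) [CommRing R] : Matrix (Fin n) (Fin (N + n)) R :=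
  (1 : Matrix (Fin (N + n)) (Fin (N + n)) R).submatrix (Fin.natAdd N) id

lemma stack_mul (Q : Matrix (Fin N) (Fin m) R) (A : Matrix (Fin n) (Fin m) R)
    (P : Matrix (Fin m) (Fin l) R) : stack Q A * P = stack (Q * P) (A * P) := by
  rw [stack, stack, ← Matrix.fromRows_mul, Matrix.submatrix_mul _ _ _ id _ Function.bijective_id,
    Matrix.submatrix_id_id]

lemma topProj_mul_stack (Q : Matrix (Fin N) (Fin m) R) (A : Matrix (Fin n) (Fin m) R) :
    topProj N n R * stack Q A = Q := by
  ext i j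
  simp [topProj, Matrix.mul_apply, Matrix.one_apply]

lemma bottomProj_mul_stack (Q : Matrix (Fin N) (Fin m) R) (A : Matrix (Fin n) (Fin m) R) :
    bottomProj N n R * stack Q A = A := by
  ext i j
  simp [bottomProj, Matrix.mul_apply, Matrix.one_apply]

lemma topProj_map {F : Type*} [FunLike F R S] [RingHomClass F R S] (φ : F) :
    (topProj N n R).map φ = topProj N n S := by
  rw [topProj, ← Matrix.submatrix_map, Matrix.map_one _ (map_zero φ) (map_one φ), topProj]

lemma bottomProj_map {F : Type*} [FunLike F R S] [RingHomClass F R S] (φ : F) :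
    (bottomProj N n R).map φ = bottomProj N n S := by
  rw [bottomProj, ← Matrix.submatrix_map, Matrix.map_one _ (map_zero φ) (map_one φ), bottomProj]

lemma mul_topProj_apply_castAdd (X₀ : Matrix (Fin m) (Fin N) R) (i : Fin m) (j : Fin N) :
    (X₀ * topProj N n R) i (Fin.castAdd n j) = X₀ i j := by
  simp [topProj, Matrix.mul_apply, Matrix.one_apply]

lemma mul_topProj_apply_natAdd (X₀ : Matrix (Fin m) (Fin N) R) (i : Fin m) (a : Fin n) :
    (X₀ * topProj N n R) i (Fin.natAdd N a) = 0 := by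
  simp [topProj, Matrix.mul_apply, Matrix.one_apply, Fin.ext_iff, Fin.is_lt, Nat.ne_of_lt,
    Nat.lt_add_right]

lemma mul_bottomProj_apply_castAdd (A₀ : Matrix (Fin m) (Fin n) R) (i : Fin m) (j : Fin N) :
    (A₀ * bottomProj N n R) i (Fin.castAdd n j) = 0 := by
  simp [bottomProj, Matrix.mul_apply, Matrix.one_apply, Fin.ext_iff, Fin.is_lt, Nat.ne_of_gt,
    Nat.lt_add_right]

lemma mul_bottomProj_apply_natAdd (A₀ : Matrix (Fin m) (Fin n) R) (i : Fin m) (a : Fin n) :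
    (A₀ * bottomProj N n R) i (Fin.natAdd N a) = A₀ i a := by
  simp [bottomProj, Matrix.mul_apply, Matrix.one_apply]

lemma det_stack (X₀ : Matrix (Fin N) (Fin N) R) (A₀ : Matrix (Fin n) (Fin N) R)
    (η : Matrix (Fin n) (Fin n) R) :
    (stack (X₀ * topProj N n R) (A₀ * topProj N n R + η * bottomProj N n R)).det =
      X₀.det * η.det := by
  have : stack (X₀ * topProj N n R) (A₀ * topProj N n R + η * bottomProj N n R) =
      (Matrix.fromBlocks X₀ 0 A₀ η).submatrix finSumFinEquiv.symm finSumFinEquiv.symm := by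
    ext i j
    refine Fin.addCases (fun i => ?_) (fun a => ?_) i <;>
      refine Fin.addCases (fun j => ?_) (fun b => ?_) j <;>
      simp [mul_topProj_apply_castAdd, mul_topProj_apply_natAdd, mul_bottomProj_apply_castAdd,
        mul_bottomProj_apply_natAdd]
  rw [this, Matrix.det_submatrix_equiv_self, Matrix.det_fromBlocks_zero₁₂]

lemma det_stack_mul_topProj_bottomProj (H : Matrix (Fin N) (Fin N) R) :
    (stack (H * topProj N n R) (bottomProj N n R)).det = H.det := by
  simpa using det_stack H (0 : Matrix (Fin n) (Fin N) R) 1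

lemma det_stack_mul (H : Matrix (Fin N) (Fin N) R) (Q : Matrix (Fin N) (Fin (N + n)) R)
    (A₀ : Matrix (Fin n) (Fin (N + n)) R) :
    (stack (H * Q) A₀).det = H.det * (stack Q A₀).det := by
  rw [← det_stack_mul_topProj_bottomProj (n := n) H, ← Matrix.det_mul, stack_mul, Matrix.mul_assoc,
    topProj_mul_stack, bottomProj_mul_stack]

end Blocks

section Slice

variable {N n k : ℕ} {R : Type*} [CommRing R] [Algebra ℂ R]

/-- Restriction to the slice formed by the pairs `([X 0; A 0], (0, 1))`. -/
def sliceEval (N n : ℕ) : Poly (N + n) n →ₐ[ℂ] Poly N n :=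
  evalAt (stack (coordX N n) (coordA N n) * topProj N n (Poly N n)) (bottomProj N n (Poly N n))

lemma evalAt_sliceEval (X₀ : Matrix (Fin N) (Fin N) R) (A₀ : Matrix (Fin n) (Fin N) R)
    (f : Poly (N + n) n) :
    evalAt X₀ A₀ (sliceEval N n f) = evalAt (stack X₀ A₀ * topProj N n R) (bottomProj N n R) f := by
  rw [sliceEval, algHom_evalAt, matrix_mul_map, stack_map, coordX_map_evalAt, coordA_map_evalAt,
    topProj_map, bottomProj_map]

/-- Every pair `(P * Q, A₀)` with `P` of width `N` is carried into the slice by the matrix with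
rows `Q` and `A₀`. -/
theorem evalAt_mul_eq_det_pow_mul_evalAt_sliceEval {f : Poly (N + n) n} (hf : f ∈ hilb (N + n) n k)
    (P : Matrix (Fin (N + n)) (Fin N) R) (Q : Matrix (Fin N) (Fin (N + n)) R)
    (A₀ : Matrix (Fin n) (Fin (N + n)) R) :
    evalAt (P * Q) A₀ f =
      (stack Q A₀).det ^ k * evalAt (Q * P) (A₀ * P) (sliceEval N n f) := by
  have := evalAt_mul_det_pow hf (stack Q A₀) (P * topProj N n R) (bottomProj N n R)
  rw [Matrix.mul_assoc, topProj_mul_stack, bottomProj_mul_stack, ← Matrix.mul_assoc,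
    stack_mul] at this
  rw [← this, evalAt_sliceEval, mul_comm]

lemma map_inv_mul_map {ι K R : Type*} [Fintype ι] [DecidableEq ι] [CommRing K] [CommRing R]
    (φ : K →+* R) (h : GL ι K) : h⁻¹.1.map φ * h.1.map φ = 1 := by
  rw [← Matrix.map_mul, ← Units.val_mul, inv_mul_cancel, Units.val_one]
  exact Matrix.map_one _ (map_zero _) (map_one _)

lemma sliceEval_mem_hilb {f : Poly (N + n) n} (hf : f ∈ hilb (N + n) n k) :
    sliceEval N n f ∈ hilb N n k := by
  intro h
  set H := h.1.map (algebraMap ℂ (Poly N n)) with hH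
  let H' := h⁻¹.1.map (algebraMap ℂ (Poly N n))
  let E := topProj N n (Poly N n)
  let F := bottomProj N n (Poly N n)
  have hinv : H' * H = 1 := map_inv_mul_map _ h
  have hne : h.1.det ^ k ≠ 0 :=
    pow_ne_zero _ ((Matrix.isUnit_iff_isUnit_det _).mp h.isUnit).ne_zero
  have hdet : (stack (H * E) F).det = algebraMap ℂ (Poly N n) h.1.det := by
    rw [det_stack_mul_topProj_bottomProj, hH, RingHom.map_det, RingHom.mapMatrix_apply]
  have key := evalAt_mul_eq_det_pow_mul_evalAt_sliceEval hf
    (stack (coordX N n) (coordA N n) * H') (H * E) F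
  rw [Matrix.mul_assoc, ← Matrix.mul_assoc H', hinv, Matrix.one_mul, hdet, Matrix.mul_assoc H,
    ← Matrix.mul_assoc E, topProj_mul_stack, ← Matrix.mul_assoc F,
    bottomProj_mul_stack, ← Matrix.mul_assoc] at key
  rw [eq_inv_smul_iff₀ hne, Algebra.smul_def, map_pow]
  exact key.symm

/-- The transition map `p_N`. -/
def transition (N n k : ℕ) : hilb (N + n) n k →ₗ[ℂ] hilb N n k :=
  (sliceEval N n).toLinearMap.restrict fun _ => sliceEval_mem_hilb

/-- The matrix `η` of coordinate functions on `Hom(ℂ^n, ℂ^n)`. -/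
def coordEta (N n : ℕ) : Matrix (Fin n) (Fin n) (AuxPoly N n) :=
  Matrix.of fun a l => X (Sum.inr (a, l))

lemma auxRestrict_eq_evalAt (N n : ℕ) : auxRestrict N n =
    evalAt (stack (1 : Matrix (Fin N) (Fin N) (AuxPoly N n)) 0 *
        ((coordX N n).map (auxIncl N n) * topProj N n (AuxPoly N n)))
      ((coordA N n).map (auxIncl N n) * topProj N n (AuxPoly N n) +
        coordEta N n * bottomProj N n (AuxPoly N n)) := by
  refine MvPolynomial.algHom_ext ?_
  rintro (⟨i, j⟩ | ⟨a, i⟩)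
  · rw [evalAt_X_inl, stack_mul, Matrix.one_mul, Matrix.zero_mul]
    refine Fin.addCases (fun i => ?_) (fun i => ?_) i <;>
      refine Fin.addCases (fun j => ?_) (fun j => ?_) j <;>
      simp [auxRestrict, mul_topProj_apply_castAdd, mul_topProj_apply_natAdd, coordX, auxIncl]
  · rw [evalAt_X_inr]
    refine Fin.addCases (fun i => ?_) (fun i => ?_) i <;>
      simp [auxRestrict, mul_topProj_apply_castAdd, mul_topProj_apply_natAdd, coordA, coordEta,
        mul_bottomProj_apply_castAdd, mul_bottomProj_apply_natAdd, auxIncl]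

lemma det_coordX_map_auxIncl (N n : ℕ) : ((coordX N n).map (auxIncl N n)).det = detX N n := by
  simp [detX, coordX, auxIncl, Matrix.map]

theorem isTransitionMap_transition (N n k : ℕ) : IsTransitionMap N n k (transition N n k) := by
  intro f
  rw [auxRestrict_eq_evalAt, evalAt_mul_eq_det_pow_mul_evalAt_sliceEval f.2, det_stack, mul_pow,
    Matrix.mul_assoc, topProj_mul_stack, Matrix.mul_one, Matrix.add_mul, Matrix.mul_assoc,
    topProj_mul_stack, Matrix.mul_assoc, bottomProj_mul_stack, Matrix.mul_one, Matrix.mul_zero,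
    add_zero, ← algHom_evalAt, evalAt_coord, det_coordX_map_auxIncl]
  rfl

lemma det_ne_zero_of_X {σ m : Type*} [Fintype m] [DecidableEq m] {v : m × m → σ}
    (hv : Function.Injective v) :
    (Matrix.of fun i j => (X (v (i, j)) : MvPolynomial σ ℂ)).det ≠ 0 := by
  have : (Matrix.of fun i j => (X (v (i, j)) : MvPolynomial σ ℂ)) =
      (rename v).mapMatrix (Matrix.mvPolynomialX m m ℂ) := by
    ext i j
    simp
  rw [this, ← AlgHom.map_det]
  exact (map_ne_zero_iff _ (rename_injective v hv)).mpr (Matrix.det_mvPolynomialX_ne_zero m ℂ)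

lemma IsTransitionMap.eq {p q : hilb (N + n) n k →ₗ[ℂ] hilb N n k} (hp : IsTransitionMap N n k p)
    (hq : IsTransitionMap N n k q) : p = q := by
  have hX : detX N n ≠ 0 := det_ne_zero_of_X (v := fun ij => Sum.inl (Sum.inl ij))
    (Sum.inl_injective.comp Sum.inl_injective)
  have hη : detEta N n ≠ 0 := det_ne_zero_of_X (v := Sum.inr) Sum.inr_injective
  refine LinearMap.ext fun f => Subtype.ext ?_
  refine (rename_injective Sum.inl Sum.inl_injective : Function.Injective (auxIncl N n)) ?_
  exact mul_left_cancel₀ (mul_ne_zero (pow_ne_zero k hX) (pow_ne_zero k hη))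
    ((hp f).symm.trans (hq f))

lemma IsTransitionMap.eq_transition {p : hilb (N + n) n k →ₗ[ℂ] hilb N n k}
    (hp : IsTransitionMap N n k p) : p = transition N n k :=
  hp.eq (isTransitionMap_transition N n k)

theorem existsUnique_isTransitionMap (N n k : ℕ) :
    ∃! p : hilb (N + n) n k →ₗ[ℂ] hilb N n k, IsTransitionMap N n k p :=
  ⟨transition N n k, isTransitionMap_transition N n k, fun _ hp => hp.eq_transition⟩

end Slice

section FirstOrder

variable {σ : Type*}

lemma aeval_inl_add_inr (D : Derivation ℂ (MvPolynomial σ ℂ) (MvPolynomial σ ℂ))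
    (f : MvPolynomial σ ℂ) :
    aeval (fun v => (TrivSqZeroExt.inl (X v) + TrivSqZeroExt.inr (D (X v)) :
      DualNumber (MvPolynomial σ ℂ))) f = TrivSqZeroExt.inl f + TrivSqZeroExt.inr (D f) := by
  induction f using MvPolynomial.induction_on with
  | C a =>
    rw [aeval_C, show (C a : MvPolynomial σ ℂ) = algebraMap ℂ _ a from rfl, D.map_algebraMap,
      TrivSqZeroExt.inr_zero, add_zero]
    rfl
  | add p q hp hq =>
    rw [map_add, hp, hq, map_add, TrivSqZeroExt.inl_add, TrivSqZeroExt.inr_add]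
    exact add_add_add_comm _ _ _ _
  | mul_X p v hp =>
    rw [map_mul, hp, aeval_X]
    refine TrivSqZeroExt.ext ?_ ?_
    · simp
    · simp [mul_comm]

lemma derivation_sum_apply {A ι : Type*} [CommRing A] [Algebra ℂ A] (s : Finset ι)
    (D : ι → Derivation ℂ A A) (f : A) : (∑ i ∈ s, D i) f = ∑ i ∈ s, D i f := by
  rw [← Derivation.coeFnAddMonoidHom_apply, map_sum, Finset.sum_apply]
  rfl

lemma commutator_apply_eq (D₁ D₂ D₃ : Derivation ℂ (MvPolynomial σ ℂ) (MvPolynomial σ ℂ))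
    (h : ∀ v, D₁ (D₂ (X v)) - D₂ (D₁ (X v)) = D₃ (X v)) (f : MvPolynomial σ ℂ) :
    D₁ (D₂ f) - D₂ (D₁ f) = D₃ f := by
  have : ⁅D₁, D₂⁆ = D₃ := derivation_ext fun v => by rw [Derivation.commutator_apply, h]
  rw [← this, Derivation.commutator_apply]

lemma one_add_single_mul_apply {R ι κ : Type*} [CommRing R] [Fintype ι] [DecidableEq ι] (m l : ι)
    (c : R) (M : Matrix ι κ R) (i : ι) (q : κ) :
    ((1 + Matrix.single m l c : Matrix ι ι R) * M) i q =
      M i q + if i = m then c * M l q else 0 := by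
  rw [Matrix.add_mul, Matrix.one_mul, Matrix.add_apply]
  split_ifs with h
  · rw [h, Matrix.single_mul_apply_same]
  · rw [Matrix.single_mul_apply_of_ne _ _ _ _ _ h]

lemma mul_one_add_single_apply {R ι κ : Type*} [CommRing R] [Fintype ι] [DecidableEq ι] (m l : ι)
    (c : R) (M : Matrix κ ι R) (i : κ) (q : ι) :
    (M * (1 + Matrix.single m l c : Matrix ι ι R)) i q =
      M i q + if q = l then M i m * c else 0 := by
  rw [Matrix.mul_add, Matrix.mul_one, Matrix.add_apply]
  split_ifs with h
  · rw [h, Matrix.mul_single_apply_same]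
  · rw [Matrix.mul_single_apply_of_ne _ _ _ _ _ h]

lemma det_one_add_single {R ι : Type*} [CommRing R] [Fintype ι] [DecidableEq ι] (m l : ι) (c : R) :
    (1 + Matrix.single m l c).det = 1 + if m = l then c else 0 := by
  have : Matrix.single m l c = Matrix.replicateCol Unit (Pi.single m c) *
      Matrix.replicateRow Unit (Pi.single l (1 : R)) := by
    ext i j
    by_cases hi : m = i <;> simp [Matrix.mul_apply, Matrix.single_apply, Pi.single_apply, hi,
      @eq_comm _ i, @eq_comm _ j]
  rw [this, Matrix.det_one_add_replicateCol_mul_replicateRow, single_one_dotProduct,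
    Pi.single_apply]
  simp only [@eq_comm _ l]

end FirstOrder

section Derivations

variable {N n k : ℕ}

/-- The variable in position `(j, l)` of the matrix `stack X A`. -/
def rowVar (j : Fin (N + n)) (l : Fin N) : Coord N n :=
  Fin.addCases (fun i => Sum.inl (i, l)) (fun a => Sum.inr (a, l)) j

/-- The derivation `(XY)^q_r = ∑_p X^q_p ∂/∂X^r_p`. -/
def leftDer (q r : Fin N) : Derivation ℂ (Poly N n) (Poly N n) :=
  ∑ p, (X (Sum.inl (q, p)) : Poly N n) • pderiv (Sum.inl (r, p))

/-- The derivation `∑_j S^j_m ∂/∂S^j_l` for `S = stack X A`, the infinitesimal form of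
`(X, A) ↦ (X h, A h)`. -/
def rightDer (m l : Fin N) : Derivation ℂ (Poly N n) (Poly N n) :=
  ∑ j, (X (rowVar j m) : Poly N n) • pderiv (rowVar j l)

/-- The infinitesimal form of `(X, A) ↦ (h⁻¹ X h, A h)` in the direction of the elementary
matrix `e_ml`. -/
def gaugeDer (m l : Fin N) : Derivation ℂ (Poly N n) (Poly N n) :=
  rightDer m l - leftDer l m

/-- The polynomial vectors transforming like `∂f/∂A^b_q` for `f ∈ hilb N n k`, in infinitesimal
form. -/
def IsCovariant (k : ℕ) (y : Fin N → Poly N n) : Prop :=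
  ∀ m l q, gaugeDer m l (y q) = (if m = l then k * y q else 0) - if q = m then y l else 0

@[simp]
lemma rowVar_castAdd (i l : Fin N) : (rowVar (Fin.castAdd n i) l : Coord N n) = Sum.inl (i, l) := by
  simp [rowVar]

@[simp]
lemma rowVar_natAdd (a : Fin n) (l : Fin N) :
    (rowVar (Fin.natAdd N a) l : Coord N n) = Sum.inr (a, l) := by
  simp [rowVar]

lemma rowVar_inj {i j : Fin (N + n)} {q l : Fin N} :
    (rowVar i q : Coord N n) = rowVar j l ↔ i = j ∧ q = l := by
  refine Fin.addCases (fun i => ?_) (fun a => ?_) i <;>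
    refine Fin.addCases (fun j => ?_) (fun b => ?_) j <;> simp [Fin.ext_iff] <;> omega

lemma leftDer_apply (q r : Fin N) (f : Poly N n) :
    leftDer q r f = ∑ p, X (Sum.inl (q, p)) * pderiv (Sum.inl (r, p)) f := by
  simp [leftDer, derivation_sum_apply]

lemma rightDer_apply (m l : Fin N) (f : Poly N n) :
    rightDer m l f = ∑ j, X (rowVar j m) * pderiv (rowVar j l) f := by
  simp [rightDer, derivation_sum_apply]

lemma leftDer_X_inl (q r i l : Fin N) :
    leftDer q r (X (Sum.inl (i, l)) : Poly N n) = if i = r then X (Sum.inl (q, l)) else 0 := by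
  by_cases h : i = r <;> simp [leftDer_apply, pderiv_X, Pi.single_apply, h]

lemma leftDer_X_inr (q r l : Fin N) (a : Fin n) :
    leftDer q r (X (Sum.inr (a, l)) : Poly N n) = 0 := by
  simp [leftDer_apply, pderiv_X]

lemma rightDer_X_rowVar (m l q : Fin N) (j : Fin (N + n)) :
    rightDer m l (X (rowVar j q) : Poly N n) = if q = l then X (rowVar j m) else 0 := by
  by_cases h : q = l <;> simp [rightDer_apply, pderiv_X, Pi.single_apply, rowVar_inj, h]

lemma rightDer_X_inl (m l i q : Fin N) :
    rightDer m l (X (Sum.inl (i, q)) : Poly N n) = if q = l then X (Sum.inl (i, m)) else 0 := by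
  simpa using rightDer_X_rowVar m l q (Fin.castAdd n i)

lemma rightDer_X_inr (m l q : Fin N) (a : Fin n) :
    rightDer m l (X (Sum.inr (a, q)) : Poly N n) = if q = l then X (Sum.inr (a, m)) else 0 := by
  simpa using rightDer_X_rowVar m l q (Fin.natAdd N a)

/-- `evalAt_mul_det_pow` at the matrix `1 + ε e_ml` over the dual numbers. -/
theorem gaugeDer_of_mem_hilb {f : Poly N n} (hf : f ∈ hilb N n k) (m l : Fin N) :
    gaugeDer m l f = if m = l then k * f else 0 := by
  let X₀ := (coordX N n).map (TrivSqZeroExt.inlAlgHom ℂ (Poly N n) (Poly N n))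
  let A₀ := (coordA N n).map (TrivSqZeroExt.inlAlgHom ℂ (Poly N n) (Poly N n))
  let H : Matrix (Fin N) (Fin N) (DualNumber (Poly N n)) := 1 + Matrix.single m l DualNumber.eps
  have left : evalAt (H * X₀) A₀ f =
      TrivSqZeroExt.inl f + TrivSqZeroExt.inr (leftDer l m f) := by
    rw [← aeval_inl_add_inr, evalAt]
    refine congrArg (fun F => aeval F f) (funext ?_)
    rintro (⟨i, q⟩ | ⟨a, q⟩)
    · simp only [Sum.elim_inl, H, one_add_single_mul_apply, leftDer_X_inl]
      by_cases h : i = m <;> simp [X₀, coordX, h, TrivSqZeroExt.ext_iff]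
    · simp [A₀, coordA, leftDer_X_inr]
  have right : evalAt (X₀ * H) (A₀ * H) f =
      TrivSqZeroExt.inl f + TrivSqZeroExt.inr (rightDer m l f) := by
    rw [← aeval_inl_add_inr, evalAt]
    refine congrArg (fun F => aeval F f) (funext ?_)
    rintro (⟨i, q⟩ | ⟨a, q⟩)
    · simp only [Sum.elim_inl, H, mul_one_add_single_apply, rightDer_X_inl]
      by_cases h : q = l <;> simp [X₀, coordX, h, TrivSqZeroExt.ext_iff]
    · simp only [Sum.elim_inr, H, mul_one_add_single_apply, rightDer_X_inr]
      by_cases h : q = l <;> simp [A₀, coordA, h, TrivSqZeroExt.ext_iff]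
  have key := evalAt_mul_det_pow hf H X₀ A₀
  rw [left, right, det_one_add_single] at key
  have epsilon_part : f * (if m = l then k else 0) + leftDer l m f = rightDer m l f := by
    have := congrArg TrivSqZeroExt.snd key
    split_ifs at this ⊢ <;> simpa [TrivSqZeroExt.snd_pow] using this
  rw [gaugeDer, Derivation.sub_apply, ← epsilon_part, add_sub_cancel_right]
  split_ifs <;> simp [mul_comm]

lemma gaugeDer_pderiv_inr (m l q : Fin N) (b : Fin n) (f : Poly N n) :
    gaugeDer m l (pderiv (Sum.inr (b, q)) f) = pderiv (Sum.inr (b, q)) (gaugeDer m l f) -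
      if q = m then pderiv (Sum.inr (b, l)) f else 0 := by
  rw [eq_sub_iff_add_eq', ← eq_sub_iff_add_eq]
  have := commutator_apply_eq (pderiv (Sum.inr (b, q))) (gaugeDer m l)
    (if q = m then pderiv (Sum.inr (b, l)) else 0) ?_ f
  · rw [this]
    split_ifs <;> rfl
  · rintro (⟨i, p⟩ | ⟨a, p⟩)
    · simp only [gaugeDer, Derivation.sub_apply, rightDer_X_inl, leftDer_X_inl]
      split_ifs <;> simp
    · simp only [gaugeDer, Derivation.sub_apply, rightDer_X_inr, leftDer_X_inr]
      split_ifs <;> simp_all [pderiv_X, Pi.single_apply, apply_ite, eq_comm]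

lemma rightDer_leftDer (m l q r : Fin N) (f : Poly N n) :
    rightDer m l (leftDer q r f) = leftDer q r (rightDer m l f) := by
  refine sub_eq_zero.mp (commutator_apply_eq (rightDer m l) (leftDer q r) 0 ?_ f)
  rintro (⟨i, p⟩ | ⟨a, p⟩)
  · simp only [rightDer_X_inl, leftDer_X_inl, apply_ite, map_zero, Derivation.zero_apply]
    split_ifs <;> simp
  · simp only [rightDer_X_inr, leftDer_X_inr, apply_ite, map_zero, Derivation.zero_apply]
    split_ifs <;> simp

lemma leftDer_leftDer (l m q r : Fin N) (f : Poly N n) :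
    leftDer l m (leftDer q r f) = leftDer q r (leftDer l m f) +
      (if q = m then leftDer l r f else 0) - if l = r then leftDer q m f else 0 := by
  rw [add_sub_assoc, ← sub_eq_iff_eq_add']
  have := commutator_apply_eq (leftDer l m) (leftDer q r)
    ((if q = m then leftDer l r else 0) - if l = r then leftDer q m else 0) ?_ f
  · rw [this, Derivation.sub_apply]
    split_ifs <;> rfl
  · rintro (⟨i, p⟩ | ⟨a, p⟩)
    · simp only [leftDer_X_inl, apply_ite, map_zero]
      split_ifs <;> simp_all [leftDer_X_inl]
    · simp only [leftDer_X_inr, map_zero, Derivation.sub_apply]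
      split_ifs <;> simp [leftDer_X_inr]

lemma gaugeDer_leftDer (m l q r : Fin N) (f : Poly N n) :
    gaugeDer m l (leftDer q r f) = leftDer q r (gaugeDer m l f) -
      (if q = m then leftDer l r f else 0) + if l = r then leftDer q m f else 0 := by
  simp only [gaugeDer, Derivation.sub_apply, rightDer_leftDer, leftDer_leftDer l m q r, map_sub]
  abel

namespace IsCovariant

lemma pderiv_inr {f : Poly N n} (hf : f ∈ hilb N n k) (b : Fin n) :
    IsCovariant k fun q => pderiv (Sum.inr (b, q)) f := by
  intro m l q
  rw [gaugeDer_pderiv_inr, gaugeDer_of_mem_hilb hf]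
  split_ifs <;> simp

variable {y z : Fin N → Poly N n}

lemma sub (hy : IsCovariant k y) (hz : IsCovariant k z) : IsCovariant k (y - z) := by
  intro m l q
  simp only [Pi.sub_apply, map_sub, hy m l q, hz m l q]
  split_ifs <;> ring

lemma smul (c : ℂ) (hy : IsCovariant k y) : IsCovariant k (c • y) := by
  intro m l q
  rw [Pi.smul_apply, Derivation.map_smul, hy]
  split_ifs <;> simp [smul_sub]

lemma sum_leftDer (hy : IsCovariant k y) : IsCovariant k fun q => ∑ r, leftDer q r (y r) := by
  intro m l q
  have term (r : Fin N) : gaugeDer m l (leftDer q r (y r)) =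
      (if m = l then k * leftDer q r (y r) else 0) - (if r = m then leftDer q r (y l) else 0) -
        (if q = m then leftDer l r (y r) else 0) + if l = r then leftDer q m (y r) else 0 := by
    rw [gaugeDer_leftDer, hy, map_sub]
    split_ifs <;> simp
  rw [map_sum, Finset.sum_congr rfl fun r _ => term r]
  simp only [Finset.sum_add_distrib, Finset.sum_sub_distrib, Finset.sum_ite_eq,
    Finset.sum_ite_eq', Finset.mem_univ, if_true, Finset.sum_ite_irrel, Finset.sum_const_zero,
    ← Finset.mul_sum]
  ring

/-- The commutator of `∂/∂S^j_l` with `S^j_m`, summed over the `N + n` rows, and the covariance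
of `y` produce the shift `k + n`. -/
theorem sum_pderiv_mul (hy : IsCovariant k y) (l : Fin N) :
    ∑ j, ∑ m, pderiv (rowVar j l) (X (rowVar j m) * y m) =
      ∑ r, leftDer l r (y r) + ((k + n : ℕ) : Poly N n) * y l := by
  have leibniz (m : Fin N) : ∑ j, pderiv (rowVar j l) (X (rowVar j m) * y m) =
      rightDer m l (y m) + if m = l then ((N + n : ℕ) : Poly N n) * y m else 0 := by
    simp only [Derivation.leibniz, smul_eq_mul, rightDer_apply, Finset.sum_add_distrib, pderiv_X,
      Pi.single_apply, rowVar_inj, true_and]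
    split_ifs <;> simp
  have covariance (m : Fin N) : rightDer m l (y m) = leftDer l m (y m) +
      (if m = l then k * y m else 0) - y l := by
    have := hy m l m
    rw [gaugeDer, Derivation.sub_apply, sub_eq_iff_eq_add, if_pos rfl] at this
    rw [this]
    ring
  rw [Finset.sum_comm]
  simp only [leibniz, covariance, Finset.sum_add_distrib, Finset.sum_sub_distrib,
    Finset.sum_ite_eq', Finset.mem_univ, if_true, Finset.sum_const, Finset.card_univ,
    Fintype.card_fin, nsmul_eq_mul]
  push_cast
  ring

end IsCovariant

end Derivations

lemma derivation_algHom_apply {σ A : Type*} [CommRing A] [Algebra ℂ A]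
    {Φ : MvPolynomial σ ℂ →ₐ[ℂ] A} {D : Derivation ℂ (MvPolynomial σ ℂ) (MvPolynomial σ ℂ)}
    {E : Derivation ℂ A A} (h : ∀ v, E (Φ (X v)) = Φ (D (X v))) (f : MvPolynomial σ ℂ) :
    E (Φ f) = Φ (D f) := by
  induction f using MvPolynomial.induction_on with
  | C a => simp only [← algebraMap_eq, AlgHom.commutes, Derivation.map_algebraMap, map_zero]
  | add p q hp hq => simp only [map_add, hp, hq]
  | mul_X p v hp => simp only [map_mul, map_add, Derivation.leibniz, smul_eq_mul, hp, h]

section Modes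

variable {N n k : ℕ}

/-- The vector `(XY - c)^s B_b f`, whose contraction with `A^a` is `mode N n c s a b f`. -/
def modeVec (c : ℂ) (s : ℕ) (b : Fin n) (f : Poly N n) (i : Fin N) : Poly N n :=
  ((opX N n * opY N n - c • (1 : Matrix (Fin N) (Fin N) (Op N n))) ^ s * opB N n) i b f

lemma opX_mul_opY_apply (q r : Fin N) :
    (opX N n * opY N n) q r = (leftDer q r : Derivation ℂ (Poly N n) (Poly N n)).toLinearMap := by
  refine LinearMap.ext fun f => ?_
  simp [Matrix.mul_apply, opX, opY, leftDer_apply]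

lemma modeVec_zero (c : ℂ) (b : Fin n) (f : Poly N n) (i : Fin N) :
    modeVec c 0 b f i = pderiv (Sum.inr (b, i)) f := by
  simp [modeVec, opB]

lemma modeVec_succ (c : ℂ) (s : ℕ) (b : Fin n) (f : Poly N n) (i : Fin N) :
    modeVec c (s + 1) b f i = ∑ r, leftDer i r (modeVec c s b f r) - c • modeVec c s b f i := by
  have : (opX N n * opY N n - c • (1 : Matrix (Fin N) (Fin N) (Op N n))) ^ (s + 1) * opB N n =
      opX N n * opY N n * ((opX N n * opY N n - c • 1) ^ s * opB N n) -
        c • ((opX N n * opY N n - c • 1) ^ s * opB N n) := by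
    rw [pow_succ', Matrix.mul_assoc, Matrix.sub_mul, Matrix.smul_mul, Matrix.one_mul]
  rw [modeVec, this, Matrix.sub_apply, Matrix.mul_apply]
  simp [opX_mul_opY_apply, modeVec]

lemma mode_apply (c : ℂ) (s : ℕ) (a b : Fin n) (f : Poly N n) :
    mode N n c s a b f = ∑ i, X (Sum.inr (a, i)) * modeVec c s b f i := by
  rw [mode, Matrix.mul_assoc, Matrix.mul_apply]
  simp [opA, modeVec]

lemma isCovariant_modeVec {f : Poly N n} (hf : f ∈ hilb N n k) (c : ℂ) (s : ℕ) (b : Fin n) :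
    IsCovariant k (modeVec c s b f) := by
  induction s with
  | zero => simpa only [← modeVec_zero c] using IsCovariant.pderiv_inr hf b
  | succ s ih =>
    have : modeVec c (s + 1) b f =
        (fun q => ∑ r, leftDer q r (modeVec c s b f r)) - c • modeVec c s b f :=
      funext (modeVec_succ c s b f)
    rw [this]
    exact ih.sum_leftDer.sub (ih.smul c)

end Modes

section SliceModes

variable {N n k : ℕ}

lemma sliceEval_X_inl_castAdd (j : Fin (N + n)) (p : Fin N) :
    sliceEval N n (X (Sum.inl (j, Fin.castAdd n p))) = X (rowVar j p) := by
  rw [sliceEval, evalAt_X_inl, mul_topProj_apply_castAdd]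
  refine Fin.addCases (fun i => ?_) (fun a => ?_) j <;> simp [coordX, coordA]

lemma sliceEval_X_inl_natAdd (j : Fin (N + n)) (a : Fin n) :
    sliceEval N n (X (Sum.inl (j, Fin.natAdd N a))) = 0 := by
  rw [sliceEval, evalAt_X_inl, mul_topProj_apply_natAdd]

lemma sliceEval_X_inr (a : Fin n) (j : Fin (N + n)) :
    sliceEval N n (X (Sum.inr (a, j))) = if Fin.natAdd N a = j then 1 else 0 := by
  simp [sliceEval, bottomProj, Matrix.one_apply]

lemma pderiv_sliceEval (j : Fin (N + n)) (l : Fin N) (f : Poly (N + n) n) :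
    pderiv (rowVar j l) (sliceEval N n f) =
      sliceEval N n (pderiv (Sum.inl (j, Fin.castAdd n l)) f) := by
  refine derivation_algHom_apply (fun v => ?_) f
  rcases v with ⟨i, q⟩ | ⟨a, q⟩
  · refine Fin.addCases (fun p => ?_) (fun b => ?_) q
    · simp [sliceEval_X_inl_castAdd, pderiv_X, Pi.single_apply, rowVar_inj, apply_ite]
    · have : Fin.natAdd N b ≠ Fin.castAdd n l := by
        simp only [ne_eq, Fin.ext_iff, Fin.val_natAdd, Fin.val_castAdd]
        lia
      simp [sliceEval_X_inl_natAdd, pderiv_X, this]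
  · simp [sliceEval_X_inr, pderiv_X, apply_ite]

lemma sliceEval_leftDer (i r : Fin (N + n)) (f : Poly (N + n) n) :
    sliceEval N n (leftDer i r f) =
      ∑ l, X (rowVar i l) * pderiv (rowVar r l) (sliceEval N n f) := by
  simp [leftDer_apply, Fin.sum_univ_add, sliceEval_X_inl_castAdd, sliceEval_X_inl_natAdd,
    pderiv_sliceEval]

/-- On the slice the identity `gaugeDer (N + b) j f = k δ f` determines the derivatives of `f`
with respect to its framing variables. -/
lemma sliceEval_pderiv_inr {f : Poly (N + n) n} (hf : f ∈ hilb (N + n) n k) (b : Fin n)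
    (j : Fin (N + n)) :
    sliceEval N n (pderiv (Sum.inr (b, j)) f) =
      (if Fin.natAdd N b = j then k * sliceEval N n f else 0) +
        ∑ l, X (rowVar j l) * pderiv (Sum.inr (b, l)) (sliceEval N n f) := by
  have key := congrArg (sliceEval N n) (gaugeDer_of_mem_hilb hf (Fin.natAdd N b) j)
  have right : sliceEval N n (rightDer (Fin.natAdd N b) j f) =
      sliceEval N n (pderiv (Sum.inr (b, j)) f) := by
    simp [rightDer_apply, Fin.sum_univ_add, sliceEval_X_inl_natAdd, sliceEval_X_inr]
  rw [gaugeDer, Derivation.sub_apply, map_sub, right, sliceEval_leftDer, sub_eq_iff_eq_add] at key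
  simpa [apply_ite] using key

variable {f : Poly (N + n) n}

/-- The divergence over the rows of `stack X A` of the restricted vector `(XY - c)^s B_b f`. -/
def sliceDiv (c : ℂ) (s : ℕ) (b : Fin n) (f : Poly (N + n) n) (l : Fin N) : Poly N n :=
  ∑ j, pderiv (rowVar j l) (sliceEval N n (modeVec c s b f j))

lemma sliceEval_modeVec_succ (c : ℂ) (s : ℕ) (b : Fin n) (f : Poly (N + n) n) (j : Fin (N + n)) :
    sliceEval N n (modeVec c (s + 1) b f j) =
      ∑ l, X (rowVar j l) * sliceDiv c s b f l - c • sliceEval N n (modeVec c s b f j) := by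
  rw [modeVec_succ, map_sub, map_smul, map_sum]
  simp only [sliceEval_leftDer, sliceDiv, Finset.mul_sum]
  rw [Finset.sum_comm]

theorem sliceDiv_eq (hf : f ∈ hilb (N + n) n k) (c : ℂ) (s : ℕ) (b : Fin n) (l : Fin N) :
    sliceDiv (c + (k + n : ℕ)) s b f l =
      modeVec c (s + 1) b (sliceEval N n f) l +
        (c + (k + n : ℕ) + k) • modeVec c s b (sliceEval N n f) l := by
  have hcov := isCovariant_modeVec (sliceEval_mem_hilb hf) c
  have divergence (s : ℕ) (l : Fin N) :
      ∑ j, pderiv (rowVar j l)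
          (∑ m, X (rowVar j m) * modeVec c s b (sliceEval N n f) m) =
        modeVec c (s + 1) b (sliceEval N n f) l +
          (c + (k + n : ℕ)) • modeVec c s b (sliceEval N n f) l := by
    simp only [map_sum]
    rw [(hcov s b).sum_pderiv_mul, modeVec_succ, add_smul, Nat.cast_smul_eq_nsmul, nsmul_eq_mul]
    ring
  induction s generalizing l with
  | zero =>
    simp only [sliceDiv, modeVec_zero, sliceEval_pderiv_inr hf, map_add, Finset.sum_add_distrib]
    simp only [← modeVec_zero c, divergence]
    have diagonal : ∑ j, pderiv (rowVar j l)
        (if Fin.natAdd N b = j then (k : Poly N n) * sliceEval N n f else 0) =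
          (k : ℂ) • modeVec c 0 b (sliceEval N n f) l := by
      simp only [apply_ite, map_zero, Finset.sum_ite_eq, Finset.mem_univ, if_true, rowVar_natAdd,
        Derivation.leibniz, Derivation.map_natCast, mul_zero, add_zero, smul_eq_mul, modeVec_zero,
        Nat.cast_smul_eq_nsmul, nsmul_eq_mul]
    rw [diagonal]
    module
  | succ s ih =>
    rw [sliceDiv]
    simp only [sliceEval_modeVec_succ, funext ih, mul_add, Finset.sum_add_distrib, mul_smul_comm,
      ← Finset.smul_sum, map_sub, map_add, Derivation.map_smul, Finset.sum_sub_distrib, divergence]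
    rw [← sliceDiv, ih]
    module

lemma sliceEval_mode (c : ℂ) (s : ℕ) (a b : Fin n) (f : Poly (N + n) n) :
    sliceEval N n (mode (N + n) n c s a b f) =
      sliceEval N n (modeVec c s b f (Fin.natAdd N a)) := by
  simp [mode_apply, sliceEval_X_inr]

theorem sliceEval_mode_zero (hf : f ∈ hilb (N + n) n k) (c c' : ℂ) (a b : Fin n) :
    sliceEval N n (mode (N + n) n c 0 a b f) =
      (if a = b then (k : ℂ) • sliceEval N n f else 0) + mode N n c' 0 a b (sliceEval N n f) := by
  rw [sliceEval_mode, modeVec_zero, sliceEval_pderiv_inr hf, mode_apply]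
  simp [modeVec_zero, eq_comm, Nat.cast_smul_eq_nsmul]

theorem sliceEval_mode_succ (hf : f ∈ hilb (N + n) n k) (c : ℂ) (s : ℕ) (a b : Fin n) :
    sliceEval N n (mode (N + n) n (c + (k + n : ℕ)) (s + 1) a b f) +
        (c + (k + n : ℕ)) • sliceEval N n (mode (N + n) n (c + (k + n : ℕ)) s a b f) =
      mode N n c (s + 1) a b (sliceEval N n f) +
        (c + (k + n : ℕ) + k) • mode N n c s a b (sliceEval N n f) := by
  rw [sliceEval_mode, sliceEval_mode, sliceEval_modeVec_succ, sub_add_cancel]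
  simp only [sliceDiv_eq hf, mode_apply, rowVar_natAdd, mul_add, Finset.sum_add_distrib,
    mul_smul_comm, ← Finset.smul_sum]

end SliceModes

section Series

variable {V : Type*} [AddCommGroup V] [Module ℂ V]

/-- If `t'(u) (1 + α u⁻¹) = t(u) (1 + β u⁻¹)`, then `t'(u) S (1 + α u⁻¹) / (1 + β u⁻¹) = t(u) S`,
for series `t`, `t'` in `u⁻¹` with coefficients in a vector space. -/
lemma sum_coeff_smul_eq_of_recursion {t t' : ℕ → V} {α β : ℂ} (S : PowerSeries ℂ)
    (h₀ : t' 0 = t 0) (h : ∀ i, t' (i + 1) + α • t' i = t (i + 1) + β • t i) (m : ℕ) :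
    ∑ x ∈ Finset.HasAntidiagonal.antidiagonal m,
      PowerSeries.coeff x.2 (S * ((1 + PowerSeries.C α * PowerSeries.X) *
        (1 + PowerSeries.C β * PowerSeries.X)⁻¹)) • t' x.1 =
      ∑ x ∈ Finset.HasAntidiagonal.antidiagonal m, PowerSeries.coeff x.2 S • t x.1 := by
  rw [← sub_eq_zero, ← Module.forall_dual_apply_eq_zero_iff ℂ]
  intro φ
  have coeff_eq (τ : ℕ → V) (R : PowerSeries ℂ) :
      φ (∑ x ∈ Finset.HasAntidiagonal.antidiagonal m, PowerSeries.coeff x.2 R • τ x.1) =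
        PowerSeries.coeff m (PowerSeries.mk (fun i => φ (τ i)) * R) := by
    simp only [map_sum, map_smul, smul_eq_mul, PowerSeries.coeff_mul, PowerSeries.coeff_mk,
      mul_comm (φ _)]
  have recursion : (1 + PowerSeries.C α * PowerSeries.X) * PowerSeries.mk (fun i => φ (t' i)) =
      (1 + PowerSeries.C β * PowerSeries.X) * PowerSeries.mk (fun i => φ (t i)) := by
    ext (_ | i)
    · simp [h₀, add_mul, mul_assoc]
    · simpa [add_mul, mul_assoc, PowerSeries.coeff_succ_X_mul] using congrArg φ (h i)
  have cancel : (1 + PowerSeries.C β * PowerSeries.X) *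
      (1 + PowerSeries.C β * PowerSeries.X)⁻¹ = 1 := PowerSeries.mul_inv_cancel _ (by simp)
  rw [map_sub, sub_eq_zero, coeff_eq, coeff_eq]
  congr 1
  linear_combination S * (1 + PowerSeries.C β * PowerSeries.X)⁻¹ * recursion +
    PowerSeries.mk (fun i => φ (t i)) * S * cancel

end Series

section TransitionModes

variable {N n k : ℕ}

lemma transition_comp_hilbMode_zero (c c' : ℂ) (a b : Fin n) :
    transition N n k ∘ₗ hilbMode (N + n) n k c' 0 a b =
      (if a = b then (k : ℂ) else 0) • transition N n k +
        hilbMode N n k c 0 a b ∘ₗ transition N n k :=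
  LinearMap.ext fun f => Subtype.ext <| (sliceEval_mode_zero f.2 c' c a b).trans <| by
    split_ifs
    · rfl
    · rw [zero_smul]
      rfl

lemma transition_comp_hilbMode_succ (c : ℂ) (s : ℕ) (a b : Fin n) :
    transition N n k ∘ₗ hilbMode (N + n) n k (c + (k + n : ℕ)) (s + 1) a b +
        (c + (k + n : ℕ)) • (transition N n k ∘ₗ hilbMode (N + n) n k (c + (k + n : ℕ)) s a b) =
      hilbMode N n k c (s + 1) a b ∘ₗ transition N n k +
        (c + (k + n : ℕ) + k) • (hilbMode N n k c s a b ∘ₗ transition N n k) :=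
  LinearMap.ext fun f => Subtype.ext (sliceEval_mode_succ f.2 c s a b)

lemma transition_hilbMode_eq_zero (c : ℂ) (s : ℕ) (a b : Fin n) {w : hilb (N + n) n k}
    (hw : transition N n k w = 0) : transition N n k (hilbMode (N + n) n k c s a b w) = 0 := by
  obtain ⟨c, rfl⟩ : ∃ d, c = d + (k + n : ℕ) := ⟨c - (k + n : ℕ), (sub_add_cancel _ _).symm⟩
  induction s with
  | zero =>
    simpa only [LinearMap.comp_apply, LinearMap.add_apply, LinearMap.smul_apply, hw, map_zero,
      smul_zero, add_zero] using LinearMap.congr_fun (transition_comp_hilbMode_zero c _ a b) w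
  | succ s ih =>
    simpa only [LinearMap.comp_apply, LinearMap.add_apply, LinearMap.smul_apply, hw, ih, map_zero,
      smul_zero, add_zero] using LinearMap.congr_fun (transition_comp_hilbMode_succ c s a b) w

end TransitionModes

section Coefficients

variable {N n k : ℕ}

lemma coeff_zero_shiftedT (a b : Fin n) :
    PowerSeries.coeff 0 (shiftedT N n k a b) = if a = b then 1 else 0 := by
  simp [shiftedT]

lemma coeff_succ_shiftedT (a b : Fin n) (s : ℕ) :
    PowerSeries.coeff (s + 1) (shiftedT N n k a b) =
      hilbMode N n k (((k + n) * (N / n) : ℕ) : ℂ) s a b := by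
  rw [shiftedT, map_add, PowerSeries.coeff_succ_X_mul, PowerSeries.coeff_mk, PowerSeries.coeff_C,
    if_neg (Nat.succ_ne_zero s), zero_add]

lemma coeff_tildeT (a b : Fin n) (m : ℕ) :
    PowerSeries.coeff m (tildeT N n k a b) = ∑ x ∈ Finset.HasAntidiagonal.antidiagonal m,
      PowerSeries.coeff x.2 (normFactor n k (N / n)) •
        PowerSeries.coeff x.1 (shiftedT N n k a b) := by
  rw [tildeT, PowerSeries.coeff_mul]
  refine Finset.sum_congr rfl fun x _ => ?_
  rw [PowerSeries.coeff_map, Algebra.smul_def, Algebra.commutes]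

lemma normFactor_succ (L : ℕ) : normFactor n k (L + 1) = normFactor n k L *
    ((1 + PowerSeries.C (((n + k) * (L + 1) : ℕ) : ℂ) * PowerSeries.X) *
      (1 + PowerSeries.C ((k + (n + k) * (L + 1) : ℕ) : ℂ) * PowerSeries.X)⁻¹) :=
  Finset.prod_Icc_succ_top (Nat.le_add_left 1 L) _

lemma transition_comp_coeff_zero_shiftedT (a b : Fin n) :
    transition N n k ∘ₗ PowerSeries.coeff 0 (shiftedT (N + n) n k a b) =
      PowerSeries.coeff 0 (shiftedT N n k a b) ∘ₗ transition N n k := by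
  rw [coeff_zero_shiftedT, coeff_zero_shiftedT]
  split_ifs
  · rfl
  · rw [LinearMap.comp_zero, LinearMap.zero_comp]

lemma transition_comp_coeff_succ_shiftedT (a b : Fin n) (s : ℕ) :
    transition N n k ∘ₗ PowerSeries.coeff (s + 1) (shiftedT (N + n) n k a b) +
        (((n + k) * (N / n + 1) : ℕ) : ℂ) •
          (transition N n k ∘ₗ PowerSeries.coeff s (shiftedT (N + n) n k a b)) =
      PowerSeries.coeff (s + 1) (shiftedT N n k a b) ∘ₗ transition N n k +
        ((k + (n + k) * (N / n + 1) : ℕ) : ℂ) •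
          (PowerSeries.coeff s (shiftedT N n k a b) ∘ₗ transition N n k) := by
  have shift : (((n + k) * (N / n + 1) : ℕ) : ℂ) = ((k + n) * (N / n) : ℕ) + (k + n : ℕ) := by
    push_cast; ring
  have shift' : (((k + n) * ((N + n) / n) : ℕ) : ℂ) = ((k + n) * (N / n) : ℕ) + (k + n : ℕ) := by
    rw [Nat.add_div_right N (Fin.pos a), ← shift, add_comm n k]
  rw [Nat.cast_add, add_comm (k : ℂ), shift]
  rcases s with _ | s
  · rw [coeff_succ_shiftedT, coeff_succ_shiftedT, shift',
      transition_comp_hilbMode_zero (((k + n) * (N / n) : ℕ) : ℂ),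
      transition_comp_coeff_zero_shiftedT, coeff_zero_shiftedT]
    split_ifs
    · rw [Module.End.one_eq_id, LinearMap.id_comp]
      module
    · simp
  · simp only [coeff_succ_shiftedT, shift']
    exact transition_comp_hilbMode_succ _ s a b

theorem transition_comp_coeff_tildeT (a b : Fin n) (m : ℕ) :
    transition N n k ∘ₗ PowerSeries.coeff m (tildeT (N + n) n k a b) =
      PowerSeries.coeff m (tildeT N n k a b) ∘ₗ transition N n k := by
  have h := sum_coeff_smul_eq_of_recursion (normFactor n k (N / n))
    (t' := fun i => transition N n k ∘ₗ PowerSeries.coeff i (shiftedT (N + n) n k a b))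
    (t := fun i => PowerSeries.coeff i (shiftedT N n k a b) ∘ₗ transition N n k)
    (transition_comp_coeff_zero_shiftedT a b) (transition_comp_coeff_succ_shiftedT a b) m
  rw [coeff_tildeT, coeff_tildeT, Nat.add_div_right N (Fin.pos a), normFactor_succ]
  refine LinearMap.ext fun w => ?_
  simpa only [LinearMap.comp_apply, LinearMap.sum_apply, LinearMap.smul_apply, map_sum,
    map_smul] using LinearMap.congr_fun h w

end Coefficients

section FockForm

variable {σ : Type*}

/-- The Fock inner product on `ℂ[x_v : v ∈ σ]`, for which the monomials are orthogonal and
`⟨x^m | x^m⟩ = m!`; for `Poly N n` it is definitionally `fockInner`. -/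
abbrev fockCore (σ : Type*) : InnerProductSpace.Core ℂ (MvPolynomial σ ℂ) where
  inner w v := ∑ m ∈ v.support, starRingEnd ℂ (w.coeff m) * v.coeff m *
    ((m.prod fun _ e => e.factorial : ℕ) : ℂ)
  conj_inner_symm w v := by
    have extend (w v : MvPolynomial σ ℂ) {s : Finset (σ →₀ ℕ)} (hs : v.support ⊆ s) :=
      Finset.sum_subset (f := fun m => starRingEnd ℂ (w.coeff m) * v.coeff m *
        ((m.prod fun _ e => e.factorial : ℕ) : ℂ)) hs fun m _ hm => by
          rw [notMem_support_iff.mp hm, mul_zero, zero_mul]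
    classical
    rw [extend v w Finset.subset_union_left,
      extend w v (Finset.subset_union_right (s₁ := w.support)), map_sum]
    refine Finset.sum_congr rfl fun m _ => ?_
    rw [map_mul, map_mul, Complex.conj_conj, Complex.conj_natCast, mul_comm (coeff m v)]
  re_inner_nonneg w := by
    rw [map_sum]
    refine Finset.sum_nonneg fun m _ => ?_
    rw [← Complex.normSq_eq_conj_mul_self, ← Complex.ofReal_natCast, ← Complex.ofReal_mul]
    exact mul_nonneg (Complex.normSq_nonneg _) (Nat.cast_nonneg _)
  add_left w w' v := by
    simp only [coeff_add, map_add, add_mul, Finset.sum_add_distrib]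
  smul_left w v c := by
    simp only [coeff_smul, smul_eq_mul, map_mul, Finset.mul_sum, mul_assoc]
  definite w hw := by
    have norm_sq : ∑ m ∈ w.support, starRingEnd ℂ (w.coeff m) * w.coeff m *
        ((m.prod fun _ e => e.factorial : ℕ) : ℂ) =
        ((∑ m ∈ w.support, Complex.normSq (w.coeff m) *
          ((m.prod fun _ e => e.factorial : ℕ) : ℝ) : ℝ) : ℂ) := by
      rw [Complex.ofReal_sum]
      simp only [Complex.ofReal_mul, Complex.ofReal_natCast, Complex.normSq_eq_conj_mul_self]
    rw [norm_sq, Complex.ofReal_eq_zero, Finset.sum_eq_zero_iff_of_nonneg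
      fun m _ => mul_nonneg (Complex.normSq_nonneg _) (Nat.cast_nonneg _)] at hw
    refine MvPolynomial.ext _ _ fun m => ?_
    by_contra hm
    have factorial_ne_zero : ((m.prod fun _ e => e.factorial : ℕ) : ℝ) ≠ 0 :=
      Nat.cast_ne_zero.mpr (Finset.prod_ne_zero_iff.mpr fun _ _ => Nat.factorial_ne_zero _)
    exact hm (Complex.normSq_eq_zero.mp
      ((mul_eq_zero.mp (hw m (mem_support_iff.mpr hm))).resolve_right factorial_ne_zero))

/-- The Fock norm on polynomials. -/
abbrev fockNormedAddCommGroup (σ : Type*) : NormedAddCommGroup (MvPolynomial σ ℂ) :=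
  (fockCore σ).toNormedAddCommGroup

attribute [local instance] fockNormedAddCommGroup

/-- The polynomials as an inner product space under the Fock inner product. -/
abbrev fockInnerProductSpace (σ : Type*) : InnerProductSpace ℂ (MvPolynomial σ ℂ) :=
  InnerProductSpace.ofCore (fockCore σ).toCore

attribute [local instance] fockInnerProductSpace

lemma inner_monomial_right (w : MvPolynomial σ ℂ) (m : σ →₀ ℕ) (c : ℂ) :
    inner ℂ w (monomial m c) =
      starRingEnd ℂ (w.coeff m) * c * ((m.prod fun _ e => e.factorial : ℕ) : ℂ) := by
  classical
  change ∑ _ ∈ _, _ = _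
  rw [Finset.sum_subset support_monomial_subset, Finset.sum_singleton, coeff_monomial, if_pos rfl]
  intro q _ hq
  rw [notMem_support_iff.mp hq, mul_zero, zero_mul]

lemma prod_factorial_add_single (m : σ →₀ ℕ) (v : σ) :
    ((m + Finsupp.single v 1).prod fun _ e => e.factorial) =
      (m v + 1) * m.prod fun _ e => e.factorial := by
  classical
  rw [← Finsupp.mul_prod_erase' _ v _ fun _ => Nat.factorial_zero,
    ← Finsupp.mul_prod_erase' m v _ fun _ => Nat.factorial_zero, Finsupp.erase_add,
    Finsupp.erase_single, add_zero, ← mul_assoc, Finsupp.add_apply, Finsupp.single_eq_same,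
    Nat.factorial_succ]

theorem inner_pderiv_left (v : σ) (f g : MvPolynomial σ ℂ) :
    inner ℂ (pderiv v f) g = inner ℂ f (X v * g) := by
  induction g using MvPolynomial.induction_on' with
  | add p q hp hq => rw [inner_add_right, mul_add, inner_add_right, hp, hq]
  | monomial m c =>
    have X_mul : (X v : MvPolynomial σ ℂ) * monomial m c = monomial (m + Finsupp.single v 1) c := by
      rw [X, monomial_mul, one_mul, add_comm]
    rw [X_mul, inner_monomial_right, inner_monomial_right, coeff_pderiv, prod_factorial_add_single]
    simp only [map_mul, map_add, Complex.conj_natCast, map_one]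
    push_cast
    ring

lemma inner_pderiv_right (v : σ) (f g : MvPolynomial σ ℂ) :
    inner ℂ f (pderiv v g) = inner ℂ (X v * f) g := by
  rw [← inner_conj_symm, inner_pderiv_left, inner_conj_symm]

theorem inner_algHom_left [Fintype σ] {Φ Ψ : MvPolynomial σ ℂ →ₐ[ℂ] MvPolynomial σ ℂ}
    (M : Matrix σ σ ℂ) (hΦ : ∀ v, Φ (X v) = ∑ w, M v w • X w)
    (hΨ : ∀ v, Ψ (X v) = ∑ w, starRingEnd ℂ (M w v) • X w) (f g : MvPolynomial σ ℂ) :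
    inner ℂ (Φ f) g = inner ℂ f (Ψ g) := by
  classical
  have pderiv_Φ (v : σ) (f : MvPolynomial σ ℂ) :
      pderiv v (Φ f) = Φ (∑ w, M w v • pderiv w f) := by
    have := derivation_algHom_apply (Φ := Φ) (E := pderiv v) (D := ∑ w, M w v • pderiv w)
      (fun u => by simp [hΦ, derivation_sum_apply, pderiv_X, Pi.single_apply]) f
    simpa only [derivation_sum_apply, Derivation.smul_apply] using this
  have constantCoeff_Φ (f : MvPolynomial σ ℂ) : constantCoeff (Φ f) = constantCoeff f :=
    RingHom.congr_fun (f := constantCoeff.comp Φ.toRingHom) (ringHom_ext (fun c => by simp)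
      fun v => by simp [hΦ]) f
  induction g using MvPolynomial.induction_on generalizing f with
  | C c =>
    rw [← algebraMap_eq, AlgHom.commutes, algebraMap_eq, C_apply, inner_monomial_right,
      inner_monomial_right, ← constantCoeff_eq, constantCoeff_Φ]
  | add p q hp hq => rw [inner_add_right, map_add, inner_add_right, hp, hq]
  | mul_X p v hp =>
    rw [mul_comm, ← inner_pderiv_left, pderiv_Φ, hp, map_mul, hΨ]
    simp only [sum_inner, inner_smul_left, inner_pderiv_left, Finset.sum_mul, inner_sum,
      smul_mul_assoc, inner_smul_right]

theorem hasOrthogonalProjection_of_homogeneousComponent_mem [Finite σ]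
    {K : Submodule ℂ (MvPolynomial σ ℂ)} (hK : ∀ w ∈ K, ∀ e, homogeneousComponent e w ∈ K) :
    K.HasOrthogonalProjection := by
  refine ⟨fun f => ?_⟩
  let L := K ⊓ restrictTotalDegree σ ℂ f.totalDegree
  have degree_le : (f - L.starProjection f).totalDegree ≤ f.totalDegree :=
    (totalDegree_sub _ _).trans (max_le le_rfl
      ((mem_restrictTotalDegree _ _ _).mp (L.starProjection_apply_mem f).2))
  refine ⟨L.starProjection f, (L.starProjection_apply_mem f).1, fun w hw => ?_⟩
  let w' := ∑ e ∈ Finset.range (f.totalDegree + 1), homogeneousComponent e w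
  have hw' : w' ∈ L := ⟨Submodule.sum_mem _ fun e _ => hK w hw e,
    Submodule.sum_mem _ fun e he => (mem_restrictTotalDegree _ _ _).mpr <|
      (homogeneousComponent_isHomogeneous e w).totalDegree_le.trans
        (Nat.lt_succ_iff.mp (Finset.mem_range.mp he))⟩
  rw [← L.sub_starProjection_mem_orthogonal f w' hw']
  refine Finset.sum_congr rfl fun m hm => ?_
  have hm' : m.degree ∈ Finset.range (f.totalDegree + 1) :=
    Finset.mem_range.mpr (Nat.lt_succ_iff.mpr ((le_totalDegree hm).trans degree_le))
  simp only [w', coeff_sum, coeff_homogeneousComponent, Finset.sum_ite_eq, hm', if_true]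

end FockForm

section AdjointMatrix

variable {E : Type*} [NormedAddCommGroup E] [InnerProductSpace ℂ E] {α β γ : Type*}

/-- `M'` is the conjugate transpose of the matrix of operators `M`, in the sense of formal
adjoints. -/
def IsAdjointMatrix (M : Matrix α β (Module.End ℂ E)) (M' : Matrix β α (Module.End ℂ E)) : Prop :=
  ∀ i j x y, inner ℂ (M i j x) y = inner ℂ x (M' j i y)

namespace IsAdjointMatrix

lemma symm {M : Matrix α β (Module.End ℂ E)} {M' : Matrix β α (Module.End ℂ E)}
    (h : IsAdjointMatrix M M') : IsAdjointMatrix M' M := fun i j x y => by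
  rw [← inner_conj_symm, ← h, inner_conj_symm]

lemma mul [Fintype β] {M : Matrix α β (Module.End ℂ E)} {M' : Matrix β α (Module.End ℂ E)}
    {P : Matrix β γ (Module.End ℂ E)} {P' : Matrix γ β (Module.End ℂ E)}
    (hM : IsAdjointMatrix M M') (hP : IsAdjointMatrix P P') :
    IsAdjointMatrix (M * P) (P' * M') := fun i j x y => by
  simp only [Matrix.mul_apply, LinearMap.sum_apply, Module.End.mul_apply, sum_inner, inner_sum,
    hM i _ _ _, hP _ j _ _]

lemma sub {M P : Matrix α β (Module.End ℂ E)} {M' P' : Matrix β α (Module.End ℂ E)}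
    (hM : IsAdjointMatrix M M') (hP : IsAdjointMatrix P P') :
    IsAdjointMatrix (M - P) (M' - P') := fun i j x y => by
  simp only [Matrix.sub_apply, LinearMap.sub_apply, inner_sub_left, inner_sub_right, hM i j x y,
    hP i j x y]

lemma smul_one [DecidableEq α] (c : ℂ) : IsAdjointMatrix (c • (1 : Matrix α α (Module.End ℂ E)))
    (starRingEnd ℂ c • (1 : Matrix α α (Module.End ℂ E))) := fun i j x y => by
  rcases eq_or_ne i j with rfl | h
  · simp [mul_comm]
  · simp [h, h.symm]

lemma pow [Fintype α] [DecidableEq α] {M M' : Matrix α α (Module.End ℂ E)}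
    (hM : IsAdjointMatrix M M') (s : ℕ) : IsAdjointMatrix (M ^ s) (M' ^ s) := by
  induction s with
  | zero => simpa using smul_one (α := α) (E := E) 1
  | succ s ih =>
    rw [pow_succ, pow_succ']
    exact ih.mul hM

end IsAdjointMatrix

end AdjointMatrix

section AdjointModes

variable {N n k : ℕ}

attribute [local instance] fockNormedAddCommGroup fockInnerProductSpace

lemma isAdjointMatrix_opY_opX : IsAdjointMatrix (opY N n) (opX N n) :=
  fun _ _ => inner_pderiv_left _

lemma isAdjointMatrix_opB_opA : IsAdjointMatrix (opB N n) (opA N n) :=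
  fun _ _ => inner_pderiv_left _

lemma isAdjointMatrix_mode (c : ℂ) (s : ℕ) :
    IsAdjointMatrix (mode N n c s) (mode N n (starRingEnd ℂ c) s) := by
  have h := isAdjointMatrix_opB_opA.symm.mul
    ((((isAdjointMatrix_opY_opX.symm.mul isAdjointMatrix_opY_opX).sub
      (.smul_one c)).pow s).mul (isAdjointMatrix_opB_opA (N := N) (n := n)))
  rwa [← Matrix.mul_assoc] at h

lemma fockInner_hilbMode (c : ℂ) (s : ℕ) (a b : Fin n) (v w : hilb N n k) :
    fockInner (v : Poly N n) (hilbMode N n k c s a b w) =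
      fockInner (hilbMode N n k (starRingEnd ℂ c) s b a v : Poly N n) w := by
  have := (isAdjointMatrix_mode (N := N) (n := n) c s).symm b a v w
  exact this.symm

theorem inner_gaugeAct_left (h : GL (Fin N) ℂ) (f g : Poly N n) :
    inner ℂ (gaugeAct h f) g = inner ℂ f (gaugeAct (star h) g) := by
  refine inner_algHom_left (Matrix.fromBlocks
    (Matrix.of fun ij pq => h.1 ij.1 pq.1 * h⁻¹.1 pq.2 ij.2) 0 0
    (Matrix.of fun ai bj => if ai.1 = bj.1 then h⁻¹.1 bj.2 ai.2 else 0)) ?_ ?_ f g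
  · rintro (⟨i, j⟩ | ⟨a, i⟩)
    · simpa [gaugeAct_X, Fintype.sum_prod_type, smul_eq_C_mul] using Finset.sum_comm
    · simp [gaugeAct_A, Fintype.sum_prod_type_right, smul_eq_C_mul, apply_ite, ite_mul]
  · rintro (⟨i, j⟩ | ⟨a, i⟩)
    · simpa [gaugeAct_X, Fintype.sum_prod_type, smul_eq_C_mul] using Finset.sum_comm
    · simp [gaugeAct_A, Fintype.sum_prod_type_right, smul_eq_C_mul, apply_ite, ite_mul]

end AdjointModes

theorem weightedHomogeneousComponent_algHom {σ τ : Type*} {w : σ → ℕ} {w' : τ → ℕ}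
    {Φ : MvPolynomial σ ℂ →ₐ[ℂ] MvPolynomial τ ℂ}
    (h : ∀ v, IsWeightedHomogeneous w' (Φ (X v)) (w v)) (e : ℕ) (f : MvPolynomial σ ℂ) :
    weightedHomogeneousComponent w' e (Φ f) = Φ (weightedHomogeneousComponent w e f) := by
  induction f using MvPolynomial.induction_on' with
  | add p q hp hq => simp only [map_add, hp, hq]
  | monomial m c =>
    have Φ_monomial : IsWeightedHomogeneous w' (Φ (monomial m c)) (Finsupp.weight w m) := by
      rw [monomial_eq, map_mul, Finsupp.prod, map_prod, ← algebraMap_eq, AlgHom.commutes,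
        algebraMap_eq, Finsupp.weight_apply, Finsupp.sum]
      exact (IsWeightedHomogeneous.prod _ _ _ fun v _ => by
        rw [map_pow]; exact (h v).pow _).C_mul c
    rw [weightedHomogeneousComponent_of_mem Φ_monomial,
      weightedHomogeneousComponent_of_mem (isWeightedHomogeneous_monomial w m c rfl)]
    split_ifs
    · rfl
    · rw [map_zero]

section Polarization

variable {σ κ : Type*} [Fintype κ]

/-- The polarization operator `∑_b x_{v b} ∂/∂x_{w b}`, the infinitesimal form of
`x_{w b} ↦ x_{w b} + ε x_{v b}`. -/
def polarization (v w : κ → σ) : Derivation ℂ (MvPolynomial σ ℂ) (MvPolynomial σ ℂ) :=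
  ∑ b, (X (v b) : MvPolynomial σ ℂ) • pderiv (w b)

lemma polarization_apply (v w : κ → σ) (f : MvPolynomial σ ℂ) :
    polarization v w f = ∑ b, X (v b) * pderiv (w b) f := by
  simp [polarization, derivation_sum_apply]

lemma pderiv_polarization [DecidableEq σ] (v w : κ → σ) (u : σ) (f : MvPolynomial σ ℂ) :
    pderiv u (polarization v w f) = polarization v w (pderiv u f) +
      ∑ b, if u = v b then pderiv (w b) f else 0 := by
  rw [polarization_apply, polarization_apply, map_sum, ← Finset.sum_add_distrib]
  refine Finset.sum_congr rfl fun b _ => ?_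
  have pderiv_comm : pderiv u (pderiv (w b) f) = pderiv (w b) (pderiv u f) :=
    sub_eq_zero.mp (commutator_apply_eq (pderiv u) (pderiv (w b)) 0
      (fun x => by simp [pderiv_X, Pi.single_apply, apply_ite]) f)
  rw [Derivation.leibniz, smul_eq_mul, smul_eq_mul, pderiv_comm, pderiv_X, Pi.single_apply]
  simp only [@eq_comm _ u, mul_ite, mul_one, mul_zero]

attribute [local instance] fockNormedAddCommGroup fockInnerProductSpace

lemma inner_polarization_left (v w : κ → σ) (f g : MvPolynomial σ ℂ) :
    inner ℂ (polarization v w f) g = inner ℂ f (polarization w v g) := by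
  simp only [polarization_apply, sum_inner, inner_sum, ← inner_pderiv_left, ← inner_pderiv_right]

lemma pderiv_eq_zero_of_polarization_self_eq_zero {v : κ → σ} {f : MvPolynomial σ ℂ}
    (h : polarization v v f = 0) (b : κ) : pderiv (v b) f = 0 := by
  have sum_norm_sq : ∑ b, ‖pderiv (v b) f‖ ^ 2 = 0 := by
    have := congrArg (inner ℂ f) h
    simp only [polarization_apply, inner_sum, ← inner_pderiv_left, inner_zero_right,
      inner_self_eq_norm_sq_to_K] at this
    exact Complex.ofReal_eq_zero.mp ((Complex.ofReal_sum _ _).trans (by simpa using this))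
  simpa using (Finset.sum_eq_zero_iff_of_nonneg fun b _ => sq_nonneg _).mp sum_norm_sq b
    (Finset.mem_univ b)

end Polarization

lemma notMem_vars_of_pderiv_eq_zero {σ : Type*} {v : σ} {f : MvPolynomial σ ℂ}
    (h : pderiv v f = 0) : v ∉ f.vars := by
  classical
  rw [mem_vars_iff_mem_support]
  rintro ⟨m, hm, hv⟩
  obtain ⟨m, rfl⟩ := exists_add_of_le (Finsupp.single_le_iff.mpr
    (Nat.one_le_iff_ne_zero.mpr (Finsupp.mem_support_iff.mp hv)))
  have := congrArg (coeff m) h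
  rw [coeff_pderiv, coeff_zero, add_comm m] at this
  exact mul_ne_zero (mem_support_iff.mp hm) (Nat.cast_add_one_ne_zero _) this

lemma pderiv_mem_restrictSupport {σ : Type*} {d : ℕ} {f : MvPolynomial σ ℂ}
    (hf : f ∈ restrictSupport ℂ {m : σ →₀ ℕ | m.degree < d + 1}) (v : σ) :
    pderiv v f ∈ restrictSupport ℂ {m : σ →₀ ℕ | m.degree < d} := by
  rw [mem_restrictSupport_iff] at hf ⊢
  intro m hm
  rw [Finset.mem_coe, mem_support_iff, coeff_pderiv] at hm
  simpa using hf (mem_support_iff.mpr (left_ne_zero_of_mul hm))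

section ProductMap

variable {α β ι τ : Type*} [Fintype ι]

/-- Coordinates on triples of an `α × ι` matrix `P`, an `ι × β` matrix `Q` and further
parameters indexed by `τ`. -/
abbrev PairCoord (α β ι τ : Type*) := (α × ι) ⊕ (ι × β) ⊕ τ

/-- The coordinate `P_ai`. -/
abbrev leftVar (i : ι) (a : α) : PairCoord α β ι τ := Sum.inl (a, i)

/-- The coordinate `Q_ib`. -/
abbrev rightVar (i : ι) (b : β) : PairCoord α β ι τ := Sum.inr (Sum.inl (i, b))

/-- Pullback of polynomials along `(P, Q, t) ↦ (P * Q, t)`. -/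
def productMap (α β ι τ : Type*) [Fintype ι] :
    MvPolynomial ((α × β) ⊕ τ) ℂ →ₐ[ℂ] MvPolynomial (PairCoord α β ι τ) ℂ :=
  aeval (Sum.elim (fun ab => ∑ i, X (leftVar i ab.1) * X (rightVar i ab.2))
    fun t => X (Sum.inr (Sum.inr t)))

/-- The operator `∑_i ∂/∂P_ai ∂/∂Q_ib`, adjoint to multiplication by `(P Q)_ab`. -/
def productLaplacian (a : α) (b : β) (F : MvPolynomial (PairCoord α β ι τ) ℂ) :
    MvPolynomial (PairCoord α β ι τ) ℂ :=
  ∑ i, pderiv (leftVar i a) (pderiv (rightVar i b) F)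

@[simp]
lemma productMap_X_inl (a : α) (b : β) :
    productMap α β ι τ (X (Sum.inl (a, b))) = ∑ i, X (leftVar i a) * X (rightVar i b) := by
  simp [productMap]

@[simp]
lemma productMap_X_inr (t : τ) :
    productMap α β ι τ (X (Sum.inr t)) = X (Sum.inr (Sum.inr t)) := by
  simp [productMap]

lemma weightedHomogeneousComponent_productMap (p q r e : ℕ) (f : MvPolynomial ((α × β) ⊕ τ) ℂ) :
    weightedHomogeneousComponent
        (Sum.elim (fun _ => p) (Sum.elim (fun _ => q) fun _ => r) : PairCoord α β ι τ → ℕ) e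
        (productMap α β ι τ f) =
      productMap α β ι τ
        (weightedHomogeneousComponent (Sum.elim (fun _ => p + q) fun _ => r) e f) := by
  refine weightedHomogeneousComponent_algHom ?_ e f
  rintro (⟨a, b⟩ | t)
  · rw [productMap_X_inl]
    exact .sum _ _ _ fun i _ => (isWeightedHomogeneous_X ..).mul (isWeightedHomogeneous_X ..)
  · rw [productMap_X_inr]
    exact isWeightedHomogeneous_X ..

lemma mem_range_productMap_of_pderiv_eq_zero {F : MvPolynomial (PairCoord α β ι τ) ℂ}
    (left : ∀ i a, pderiv (leftVar i a) F = 0) (right : ∀ i b, pderiv (rightVar i b) F = 0) :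
    F ∈ (productMap α β ι τ).toLinearMap.range := by
  have mem_supported : F ∈ supported ℂ (Set.range fun t => Sum.inr (Sum.inr t)) := by
    rw [mem_supported]
    rintro (⟨a, i⟩ | ⟨i, b⟩ | t) hv
    · exact (notMem_vars_of_pderiv_eq_zero (left i a) hv).elim
    · exact (notMem_vars_of_pderiv_eq_zero (right i b) hv).elim
    · exact ⟨t, rfl⟩
  refine Algebra.adjoin_le (S := (productMap α β ι τ).range) ?_ mem_supported
  rintro _ ⟨_, ⟨t, rfl⟩, rfl⟩
  exact ⟨X (Sum.inr t), productMap_X_inr t⟩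

attribute [local instance] fockNormedAddCommGroup fockInnerProductSpace

lemma inner_productLaplacian_left (a : α) (b : β) (F G : MvPolynomial (PairCoord α β ι τ) ℂ) :
    inner ℂ (productLaplacian a b F) G =
      inner ℂ F (productMap α β ι τ (X (Sum.inl (a, b))) * G) := by
  simp only [productLaplacian, productMap_X_inl, sum_inner, inner_pderiv_left, Finset.sum_mul,
    inner_sum, mul_left_comm (X (leftVar _ a)), mul_assoc]

lemma productLaplacian_mem_orthogonal {F : MvPolynomial (PairCoord α β ι τ) ℂ}
    (hF : F ∈ (productMap α β ι τ).toLinearMap.rangeᗮ) (a : α) (b : β) :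
    productLaplacian a b F ∈ (productMap α β ι τ).toLinearMap.rangeᗮ := by
  rw [Submodule.mem_orthogonal'] at hF ⊢
  rintro _ ⟨f, rfl⟩
  rw [inner_productLaplacian_left]
  exact hF _ ⟨X (Sum.inl (a, b)) * f, map_mul (productMap α β ι τ) _ _⟩

lemma productLaplacian_mem_restrictSupport {d : ℕ} {F : MvPolynomial (PairCoord α β ι τ) ℂ}
    (hF : F ∈ restrictSupport ℂ {m : PairCoord α β ι τ →₀ ℕ | m.degree < d + 1}) (a : α) (b : β) :
    productLaplacian a b F ∈ restrictSupport ℂ {m : PairCoord α β ι τ →₀ ℕ | m.degree < d} :=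
  Submodule.sum_mem _ fun _ _ => pderiv_mem_restrictSupport
    (restrictSupport_mono _ (fun _ hm => hm.trans (Nat.lt_succ_self _))
      (pderiv_mem_restrictSupport hF _)) _

lemma hasOrthogonalProjection_range_productMap [Finite α] [Finite β] [Finite τ] :
    (productMap α β ι τ).toLinearMap.range.HasOrthogonalProjection := by
  refine hasOrthogonalProjection_of_homogeneousComponent_mem ?_
  rintro _ ⟨f, rfl⟩ e
  have weight_eq : (Sum.elim (fun _ => 1) (Sum.elim (fun _ => 1) fun _ => 1) :
      PairCoord α β ι τ → ℕ) = 1 := by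
    ext (_ | _ | _) <;> rfl
  have := weightedHomogeneousComponent_productMap (ι := ι) 1 1 1 e f
  rw [weight_eq] at this
  exact ⟨_, this.symm⟩

lemma hasOrthogonalProjection_ker_productMap [Finite α] [Finite β] [Finite τ] :
    (productMap α β ι τ).toLinearMap.ker.HasOrthogonalProjection := by
  refine hasOrthogonalProjection_of_homogeneousComponent_mem fun f hf e => ?_
  have weight_eq : (Sum.elim (fun _ => 1 + 0) fun _ => 1 : (α × β) ⊕ τ → ℕ) = 1 := by
    ext (_ | _) <;> rfl
  have := weightedHomogeneousComponent_productMap (ι := ι) 1 0 1 e f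
  rw [weight_eq, show productMap α β ι τ f = 0 from hf, map_zero] at this
  exact this.symm

end ProductMap

section FirstFundamentalTheorem

variable {α β ι τ : Type*} [Fintype α] [Fintype β]

/-- Invariance under `(P, Q) ↦ (P h⁻¹, h Q)`, in infinitesimal form. -/
def IsPairInvariant (F : MvPolynomial (PairCoord α β ι τ) ℂ) : Prop :=
  ∀ i j, polarization (leftVar i) (leftVar j) F = polarization (rightVar j) (rightVar i) F

lemma IsPairInvariant.sub {F G : MvPolynomial (PairCoord α β ι τ) ℂ} (hF : IsPairInvariant F)
    (hG : IsPairInvariant G) : IsPairInvariant (F - G) := by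
  intro i j
  rw [map_sub, map_sub, hF, hG]

variable [Fintype ι]

lemma isPairInvariant_productMap (f : MvPolynomial ((α × β) ⊕ τ) ℂ) :
    IsPairInvariant (productMap α β ι τ f) := by
  classical
  intro i j
  have := derivation_algHom_apply (Φ := productMap α β ι τ) (D := 0)
    (E := polarization (leftVar i) (leftVar j) - polarization (rightVar j) (rightVar i)) ?_ f
  · simpa [sub_eq_zero] using this
  rintro (⟨a, b⟩ | t)
  · simp [polarization_apply, pderiv_X, Pi.single_apply, Finset.sum_add_distrib, ite_and, mul_comm,
      Finset.sum_ite_irrel]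
  · simp [polarization_apply, pderiv_X]

lemma IsPairInvariant.productLaplacian {F : MvPolynomial (PairCoord α β ι τ) ℂ}
    (hF : IsPairInvariant F) (a : α) (b : β) : IsPairInvariant (productLaplacian a b F) := by
  classical
  intro i j
  have left (l : ι) : polarization (leftVar i) (leftVar j)
        (pderiv (leftVar l a) (pderiv (rightVar l b) F)) =
      pderiv (leftVar l a) (pderiv (rightVar l b) (polarization (leftVar i) (leftVar j) F)) -
        if l = i then pderiv (leftVar j a) (pderiv (rightVar l b) F) else 0 := by
    by_cases h : l = i <;> simp [pderiv_polarization, h]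
  have right (l : ι) : polarization (rightVar j) (rightVar i)
        (pderiv (leftVar l a) (pderiv (rightVar l b) F)) =
      pderiv (leftVar l a) (pderiv (rightVar l b) (polarization (rightVar j) (rightVar i) F)) -
        if l = j then pderiv (leftVar l a) (pderiv (rightVar i b) F) else 0 := by
    by_cases h : l = j <;> simp [pderiv_polarization, h]
  simp only [MatrixModel.productLaplacian, map_sum, left, right, hF i j, Finset.sum_sub_distrib,
    Finset.sum_ite_eq', Finset.mem_univ, if_true]

/-- A Capelli identity: on invariants the Casimir operator of `gl_ι` factors through the
operators `productLaplacian`. -/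
lemma IsPairInvariant.sum_polarization_polarization {F : MvPolynomial (PairCoord α β ι τ) ℂ}
    (hF : IsPairInvariant F) :
    ∑ i, ∑ j, polarization (rightVar j) (rightVar i) (polarization (rightVar i) (rightVar j) F) =
      ∑ a, ∑ b, productMap α β ι τ (X (Sum.inl (a, b))) * MatrixModel.productLaplacian a b F := by
  classical
  have term (i j : ι) :
      polarization (rightVar j) (rightVar i) (polarization (rightVar i) (rightVar j) F) =
        ∑ a, ∑ b, X (leftVar j a) * X (rightVar j b) *
          pderiv (leftVar i a) (pderiv (rightVar i b) F) := by
    rw [← hF j i, polarization_apply, Finset.sum_comm]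
    refine Finset.sum_congr rfl fun b _ => ?_
    rw [pderiv_polarization, polarization_apply]
    simp [Finset.mul_sum, mul_left_comm, mul_assoc]
  simp only [term, productMap_X_inl, MatrixModel.productLaplacian, Finset.sum_mul_sum]
  rw [Finset.sum_comm, Finset.sum_comm_cycle]
  exact Finset.sum_congr rfl fun a _ => Finset.sum_comm_cycle

attribute [local instance] fockNormedAddCommGroup fockInnerProductSpace

lemma IsPairInvariant.mem_range_of_productLaplacian_eq_zero
    {F : MvPolynomial (PairCoord α β ι τ) ℂ} (hF : IsPairInvariant F)
    (hΔ : ∀ a b, MatrixModel.productLaplacian a b F = 0) :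
    F ∈ (productMap α β ι τ).toLinearMap.range := by
  have sum_norm_sq : ∑ i, ∑ j, ‖polarization (rightVar i) (rightVar j) F‖ ^ 2 = 0 := by
    have := congrArg (inner ℂ F) hF.sum_polarization_polarization
    simp only [hΔ, mul_zero, Finset.sum_const_zero, inner_zero_right, inner_sum,
      ← inner_polarization_left, inner_self_eq_norm_sq_to_K] at this
    exact Complex.ofReal_eq_zero.mp (by simpa using this)
  have right (i j : ι) : polarization (rightVar i) (rightVar j) F = 0 := by
    have := (Finset.sum_eq_zero_iff_of_nonneg fun i _ =>
      Finset.sum_nonneg fun j _ => sq_nonneg _).mp sum_norm_sq i (Finset.mem_univ i)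
    simpa using (Finset.sum_eq_zero_iff_of_nonneg fun j _ => sq_nonneg _).mp this j
      (Finset.mem_univ j)
  exact mem_range_productMap_of_pderiv_eq_zero
    (fun i => pderiv_eq_zero_of_polarization_self_eq_zero ((hF i i).trans (right i i)))
    fun i => pderiv_eq_zero_of_polarization_self_eq_zero (right i i)

lemma IsPairInvariant.eq_zero_of_mem_orthogonal {F : MvPolynomial (PairCoord α β ι τ) ℂ}
    (hF : IsPairInvariant F) (hF' : F ∈ (productMap α β ι τ).toLinearMap.rangeᗮ) : F = 0 := by
  suffices ∀ d, ∀ F ∈ restrictSupport ℂ {m : PairCoord α β ι τ →₀ ℕ | m.degree < d},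
      IsPairInvariant F → F ∈ (productMap α β ι τ).toLinearMap.rangeᗮ → F = 0 from
    this (F.totalDegree + 1) F (fun m hm => Nat.lt_succ_of_le (le_totalDegree hm)) hF hF'
  intro d
  induction d with
  | zero =>
    intro F hF _ _
    simpa [mem_restrictSupport_iff] using hF
  | succ d ih =>
    intro F hd hF hF'
    have := hF.mem_range_of_productLaplacian_eq_zero fun a b => ih _
      (productLaplacian_mem_restrictSupport hd a b) (hF.productLaplacian a b)
      (productLaplacian_mem_orthogonal hF' a b)
    exact inner_self_eq_zero.mp (hF' F this)

/-- The first fundamental theorem of invariant theory for `GL_ι`. -/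
theorem IsPairInvariant.mem_range_productMap [Finite τ] {F : MvPolynomial (PairCoord α β ι τ) ℂ}
    (hF : IsPairInvariant F) : F ∈ (productMap α β ι τ).toLinearMap.range := by
  have := hasOrthogonalProjection_range_productMap (α := α) (β := β) (ι := ι) (τ := τ)
  let K := (productMap α β ι τ).toLinearMap.range
  obtain ⟨f, hf⟩ := K.starProjection_apply_mem F
  have eq_proj : F = K.starProjection F := sub_eq_zero.mp <|
    (hF.sub (hf ▸ isPairInvariant_productMap f)).eq_zero_of_mem_orthogonal
      (K.sub_starProjection_mem_orthogonal F)
  exact eq_proj ▸ ⟨f, hf⟩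

end FirstFundamentalTheorem

section Lift

variable {N n k : ℕ} {R S : Type*} [CommRing R] [Algebra ℂ R] [CommRing S] [Algebra ℂ S]

/-- The value at `(P Q, A₀)` of any `f ∈ hilb (N + n) n k` restricting to `g` on the slice. -/
def liftEval (k : ℕ) (P : Matrix (Fin (N + n)) (Fin N) R) (Q : Matrix (Fin N) (Fin (N + n)) R)
    (A₀ : Matrix (Fin n) (Fin (N + n)) R) (g : Poly N n) : R :=
  (stack Q A₀).det ^ k * evalAt (Q * P) (A₀ * P) g

lemma algHom_liftEval (φ : R →ₐ[ℂ] S) (P : Matrix (Fin (N + n)) (Fin N) R)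
    (Q : Matrix (Fin N) (Fin (N + n)) R) (A₀ : Matrix (Fin n) (Fin (N + n)) R) (g : Poly N n) :
    φ (liftEval k P Q A₀ g) = liftEval k (P.map φ) (Q.map φ) (A₀.map φ) g := by
  simp only [liftEval, map_mul, map_pow, algHom_evalAt, matrix_mul_map, AlgHom.map_det,
    AlgHom.mapMatrix_apply, stack_map]

lemma liftEval_mul_left {g : Poly N n} (hg : g ∈ hilb N n k) (H : Matrix (Fin N) (Fin N) R)
    (P : Matrix (Fin (N + n)) (Fin N) R) (Q : Matrix (Fin N) (Fin (N + n)) R)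
    (A₀ : Matrix (Fin n) (Fin (N + n)) R) :
    liftEval k (P * H) Q A₀ g = liftEval k P (H * Q) A₀ g := by
  rw [liftEval, liftEval, ← Matrix.mul_assoc, ← Matrix.mul_assoc, ← evalAt_mul_det_pow hg,
    det_stack_mul, ← Matrix.mul_assoc, mul_pow]
  ring

lemma liftEval_mul_right (h h' : Matrix (Fin (N + n)) (Fin (N + n)) R) (hh : h' * h = 1)
    (P : Matrix (Fin (N + n)) (Fin N) R) (Q : Matrix (Fin N) (Fin (N + n)) R)
    (A₀ : Matrix (Fin n) (Fin (N + n)) R) (g : Poly N n) :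
    liftEval k (h * P) (Q * h') (A₀ * h') g = h'.det ^ k * liftEval k P Q A₀ g := by
  have cancel {m : ℕ} (B : Matrix (Fin m) (Fin (N + n)) R) : B * h' * (h * P) = B * P := by
    rw [Matrix.mul_assoc, ← Matrix.mul_assoc h', hh, Matrix.one_mul]
  rw [liftEval, liftEval, ← stack_mul, Matrix.det_mul, cancel, cancel, mul_pow]
  ring

lemma liftEval_stack (X₀ : Matrix (Fin N) (Fin N) R) (A₀ : Matrix (Fin n) (Fin N) R)
    (g : Poly N n) :
    liftEval k (stack X₀ A₀) (topProj N n R) (bottomProj N n R) g = evalAt X₀ A₀ g := by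
  have := det_stack_mul_topProj_bottomProj (n := n) (1 : Matrix (Fin N) (Fin N) R)
  rw [Matrix.one_mul, Matrix.det_one] at this
  rw [liftEval, topProj_mul_stack, bottomProj_mul_stack, this, one_pow, one_mul]

/-- Coordinates on triples `(P, Q, A₀)` for which `(P Q, A₀)` is a matrix of rank at most `N`
with a framing, of size `N + n`. -/
abbrev LiftCoord (N n : ℕ) := PairCoord (Fin (N + n)) (Fin (N + n)) (Fin N) (Fin n × Fin (N + n))

/-- Pullback of polynomials along `(P, Q, A₀) ↦ (P Q, A₀)`. -/
abbrev liftMap (N n : ℕ) : Poly (N + n) n →ₐ[ℂ] MvPolynomial (LiftCoord N n) ℂ :=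
  productMap (Fin (N + n)) (Fin (N + n)) (Fin N) (Fin n × Fin (N + n))

/-- Evaluation of a polynomial in `(P, Q, A₀)` at matrices over a commutative algebra. -/
def evalTriple (P : Matrix (Fin (N + n)) (Fin N) R) (Q : Matrix (Fin N) (Fin (N + n)) R)
    (A₀ : Matrix (Fin n) (Fin (N + n)) R) : MvPolynomial (LiftCoord N n) ℂ →ₐ[ℂ] R :=
  aeval (Sum.elim (fun v => P v.1 v.2) (Sum.elim (fun v => Q v.1 v.2) fun v => A₀ v.1 v.2))

/-- The matrix of coordinate functions `P` on triples `(P, Q, A₀)`. -/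
def coordP (N n : ℕ) : Matrix (Fin (N + n)) (Fin N) (MvPolynomial (LiftCoord N n) ℂ) :=
  Matrix.of fun a i => X (leftVar i a)

/-- The matrix of coordinate functions `Q` on triples `(P, Q, A₀)`. -/
def coordQ (N n : ℕ) : Matrix (Fin N) (Fin (N + n)) (MvPolynomial (LiftCoord N n) ℂ) :=
  Matrix.of fun i b => X (rightVar i b)

/-- The matrix of coordinate functions `A₀` on triples `(P, Q, A₀)`. -/
def coordFraming (N n : ℕ) : Matrix (Fin n) (Fin (N + n)) (MvPolynomial (LiftCoord N n) ℂ) :=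
  Matrix.of fun a i => X (Sum.inr (Sum.inr (a, i)))

/-- The polynomial `liftEval k P Q A₀ g` in the coordinates `(P, Q, A₀)`. -/
def liftPoly (k : ℕ) (g : Poly N n) : MvPolynomial (LiftCoord N n) ℂ :=
  liftEval k (coordP N n) (coordQ N n) (coordFraming N n) g

lemma evalTriple_liftPoly (P : Matrix (Fin (N + n)) (Fin N) R)
    (Q : Matrix (Fin N) (Fin (N + n)) R) (A₀ : Matrix (Fin n) (Fin (N + n)) R) (g : Poly N n) :
    evalTriple P Q A₀ (liftPoly k g) = liftEval k P Q A₀ g := by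
  rw [liftPoly, algHom_liftEval]
  congr 1 <;> ext <;> simp [evalTriple, coordP, coordQ, coordFraming]

lemma evalTriple_liftMap (P : Matrix (Fin (N + n)) (Fin N) R)
    (Q : Matrix (Fin N) (Fin (N + n)) R) (A₀ : Matrix (Fin n) (Fin (N + n)) R)
    (f : Poly (N + n) n) : evalTriple P Q A₀ (liftMap N n f) = evalAt (P * Q) A₀ f := by
  have : (evalTriple P Q A₀).comp (liftMap N n) = evalAt (P * Q) A₀ := by
    ext (⟨a, b⟩ | ⟨a, i⟩) <;> simp [evalTriple, Matrix.mul_apply]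
  rw [← this, AlgHom.comp_apply]

lemma evalTriple_coord (F : MvPolynomial (LiftCoord N n) ℂ) :
    evalTriple (coordP N n) (coordQ N n) (coordFraming N n) F = F := by
  have : evalTriple (coordP N n) (coordQ N n) (coordFraming N n) = AlgHom.id ℂ _ := by
    ext1 (_ | _ | _) <;> exact aeval_X _ _
  rw [this, AlgHom.id_apply]

lemma liftMap_of_mem_hilb {f : Poly (N + n) n} (hf : f ∈ hilb (N + n) n k) :
    liftMap N n f = liftPoly k (sliceEval N n f) := by
  rw [← evalTriple_coord (liftMap N n f), evalTriple_liftMap,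
    evalAt_mul_eq_det_pow_mul_evalAt_sliceEval hf, liftPoly, liftEval]

/-- `liftEval_mul_left` at the matrix `1 + ε e_ij` over the dual numbers. -/
theorem isPairInvariant_liftPoly {g : Poly N n} (hg : g ∈ hilb N n k) :
    IsPairInvariant (liftPoly k g) := by
  intro i j
  let inl : MvPolynomial (LiftCoord N n) ℂ →ₐ[ℂ] DualNumber (MvPolynomial (LiftCoord N n) ℂ) :=
    TrivSqZeroExt.inlAlgHom ℂ _ _
  let P := (coordP N n).map inl
  let Q := (coordQ N n).map inl
  let A₀ := (coordFraming N n).map inl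
  let H : Matrix (Fin N) (Fin N) (DualNumber (MvPolynomial (LiftCoord N n) ℂ)) :=
    1 + Matrix.single i j DualNumber.eps
  have left (F : MvPolynomial (LiftCoord N n) ℂ) : evalTriple (P * H) Q A₀ F =
      TrivSqZeroExt.inl F + TrivSqZeroExt.inr (polarization (leftVar i) (leftVar j) F) := by
    rw [← aeval_inl_add_inr, evalTriple]
    refine congrArg (fun Φ => aeval Φ F) (funext ?_)
    rintro (⟨a, l⟩ | ⟨l, b⟩ | t)
    · simp only [Sum.elim_inl, H, mul_one_add_single_apply]
      by_cases h : l = j <;>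
        simp [P, inl, coordP, polarization_apply, pderiv_X, Pi.single_apply, h,
          TrivSqZeroExt.ext_iff]
    · simp [Q, inl, coordQ, polarization_apply, pderiv_X]
    · simp [A₀, inl, coordFraming, polarization_apply, pderiv_X]
  have right (F : MvPolynomial (LiftCoord N n) ℂ) : evalTriple P (H * Q) A₀ F =
      TrivSqZeroExt.inl F + TrivSqZeroExt.inr (polarization (rightVar j) (rightVar i) F) := by
    rw [← aeval_inl_add_inr, evalTriple]
    refine congrArg (fun Φ => aeval Φ F) (funext ?_)
    rintro (⟨a, l⟩ | ⟨l, b⟩ | t)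
    · simp [P, inl, coordP, polarization_apply, pderiv_X]
    · simp only [Sum.elim_inl, Sum.elim_inr, H, one_add_single_mul_apply]
      by_cases h : l = i <;>
        simp [Q, inl, coordQ, polarization_apply, pderiv_X, Pi.single_apply, h,
          TrivSqZeroExt.ext_iff]
    · simp [A₀, inl, coordFraming, polarization_apply, pderiv_X]
  have key := liftEval_mul_left hg H P Q A₀
  rw [← evalTriple_liftPoly, ← evalTriple_liftPoly, left, right] at key
  simpa using congrArg TrivSqZeroExt.snd key

end Lift

section Lift

variable {N n k : ℕ}

attribute [local instance] fockNormedAddCommGroup fockInnerProductSpace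

lemma liftMap_gaugeAct (h : GL (Fin (N + n)) ℂ) (f : Poly (N + n) n) :
    liftMap N n (gaugeAct h f) =
      evalTriple (h.1.map (algebraMap ℂ (MvPolynomial (LiftCoord N n) ℂ)) * coordP N n)
        (coordQ N n * h⁻¹.1.map (algebraMap ℂ (MvPolynomial (LiftCoord N n) ℂ)))
        (coordFraming N n * h⁻¹.1.map (algebraMap ℂ (MvPolynomial (LiftCoord N n) ℂ)))
        (liftMap N n f) := by
  rw [← evalTriple_coord (liftMap N n (gaugeAct h f)), evalTriple_liftMap, evalTriple_liftMap,
    evalAt_gaugeAct]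
  simp only [Matrix.mul_assoc]

lemma liftMap_gaugeAct_of_eq_liftPoly {f : Poly (N + n) n} {g : Poly N n}
    (hf : liftMap N n f = liftPoly k g) (h : GL (Fin (N + n)) ℂ) :
    liftMap N n (gaugeAct h f) = (h.1.det ^ k)⁻¹ • liftMap N n f := by
  have det_inv : (h⁻¹.1.map (algebraMap ℂ (MvPolynomial (LiftCoord N n) ℂ))).det =
      algebraMap ℂ _ h.1.det⁻¹ := by
    rw [Matrix.coe_units_inv, ← RingHom.mapMatrix_apply, ← RingHom.map_det, Matrix.det_nonsing_inv,
      Ring.inverse_eq_inv']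
  rw [liftMap_gaugeAct, hf, evalTriple_liftPoly, liftEval_mul_right _ _ (map_inv_mul_map _ h),
    det_inv, Algebra.smul_def, ← map_pow, inv_pow, liftPoly]

lemma inner_gaugeAct_right (h : GL (Fin N) ℂ) (f g : Poly N n) :
    inner ℂ f (gaugeAct h g) = inner ℂ (gaugeAct (star h) f) g := by
  rw [inner_gaugeAct_left, star_star]

theorem mem_hilb_of_mem_orthogonal_of_liftMap_eq {f : Poly (N + n) n} {g : Poly N n}
    (hf : f ∈ (liftMap N n).toLinearMap.kerᗮ) (hfg : liftMap N n f = liftPoly k g) :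
    f ∈ hilb (N + n) n k := by
  intro h
  have difference_mem : gaugeAct h f - (h.1.det ^ k)⁻¹ • f ∈ (liftMap N n).toLinearMap.ker := by
    rw [LinearMap.mem_ker, AlgHom.toLinearMap_apply, map_sub, map_smul,
      liftMap_gaugeAct_of_eq_liftPoly hfg, sub_self]
  have gaugeAct_mem : gaugeAct h f ∈ (liftMap N n).toLinearMap.kerᗮ := fun w hw => by
    rw [inner_gaugeAct_right]
    refine hf _ ?_
    rw [LinearMap.mem_ker, AlgHom.toLinearMap_apply, liftMap_gaugeAct]
    exact (congrArg _ hw).trans (map_zero _)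
  exact sub_eq_zero.mp <| inner_self_eq_zero.mp <|
    (sub_mem gaugeAct_mem (Submodule.smul_mem _ _ hf)) _ difference_mem

lemma sliceEval_of_liftMap_eq {f : Poly (N + n) n} {g : Poly N n}
    (hfg : liftMap N n f = liftPoly k g) : sliceEval N n f = g := by
  have := congrArg (evalTriple (stack (coordX N n) (coordA N n)) (topProj N n _)
    (bottomProj N n _)) hfg
  rwa [evalTriple_liftMap, evalTriple_liftPoly, liftEval_stack, evalAt_coord] at this

theorem exists_mem_orthogonal_liftMap_eq {g : Poly N n} (hg : g ∈ hilb N n k) :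
    ∃ f ∈ (liftMap N n).toLinearMap.kerᗮ, liftMap N n f = liftPoly k g := by
  obtain ⟨f, hf⟩ := (isPairInvariant_liftPoly hg).mem_range_productMap
  let K := (liftMap N n).toLinearMap.ker
  have : K.HasOrthogonalProjection := hasOrthogonalProjection_ker_productMap
  refine ⟨f - K.starProjection f, K.sub_starProjection_mem_orthogonal f, ?_⟩
  rw [map_sub, show liftMap N n (K.starProjection f) = 0 from K.starProjection_apply_mem f,
    sub_zero]
  exact hf

end Lift

section Transition

variable {N n k : ℕ}

attribute [local instance] fockNormedAddCommGroup fockInnerProductSpace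

theorem exists_mem_orthogonal_transition_eq (g : hilb N n k) :
    ∃ f ∈ (transition N n k).kerᗮ, transition N n k f = g := by
  obtain ⟨f, hf, hfg⟩ := exists_mem_orthogonal_liftMap_eq g.2
  refine ⟨⟨f, mem_hilb_of_mem_orthogonal_of_liftMap_eq hf hfg⟩, fun w hw => hf w ?_,
    Subtype.ext (sliceEval_of_liftMap_eq hfg)⟩
  have hw : sliceEval N n (w : Poly (N + n) n) = 0 := congrArg Subtype.val hw
  rw [LinearMap.mem_ker, AlgHom.toLinearMap_apply, liftMap_of_mem_hilb w.2, hw, liftPoly, liftEval,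
    map_zero, mul_zero]

lemma eq_of_transition_eq_of_mem_orthogonal {f g : hilb (N + n) n k}
    (hf : f ∈ (transition N n k).kerᗮ) (hg : g ∈ (transition N n k).kerᗮ)
    (h : transition N n k f = transition N n k g) : f = g :=
  sub_eq_zero.mp <| inner_self_eq_zero.mp <| sub_mem hf hg _ (LinearMap.sub_mem_ker_iff.mpr h)

end Transition

section HermitianSection

variable {N n k : ℕ}

attribute [local instance] fockNormedAddCommGroup fockInnerProductSpace

lemma mem_orthogonal_ker_transition_iff {f : hilb (N + n) n k} :
    f ∈ (transition N n k).kerᗮ ↔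
      ∀ w : hilb (N + n) n k, transition N n k w = 0 → fockInner (w : Poly (N + n) n) f = 0 :=
  Iff.rfl

lemma isHermitianSection_transition_iff {σ : hilb N n k →ₗ[ℂ] hilb (N + n) n k} :
    IsHermitianSection (transition N n k) σ ↔
      ∀ v, transition N n k (σ v) = v ∧ σ v ∈ (transition N n k).kerᗮ := by
  simp only [IsHermitianSection, LinearMap.ext_iff, ← forall_and,
    mem_orthogonal_ker_transition_iff, LinearMap.comp_apply, LinearMap.id_apply]

theorem existsUnique_isHermitianSection_transition (N n k : ℕ) :
    ∃! σ : hilb N n k →ₗ[ℂ] hilb (N + n) n k, IsHermitianSection (transition N n k) σ := by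
  choose σ mem_orthogonal transition_σ using exists_mem_orthogonal_transition_eq (N := N) (n := n)
    (k := k)
  refine ⟨⟨⟨σ, fun u v => ?_⟩, fun c v => ?_⟩,
    isHermitianSection_transition_iff.mpr fun v => ⟨transition_σ v, mem_orthogonal v⟩,
    fun τ hτ => LinearMap.ext fun v => ?_⟩
  · refine eq_of_transition_eq_of_mem_orthogonal (mem_orthogonal _)
      (add_mem (mem_orthogonal u) (mem_orthogonal v)) ?_
    simp only [map_add, transition_σ]
  · refine eq_of_transition_eq_of_mem_orthogonal (mem_orthogonal _)
      (Submodule.smul_mem _ c (mem_orthogonal v)) ?_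
    simp only [map_smul, transition_σ, RingHom.id_apply]
  · obtain ⟨transition_τ, τ_mem⟩ := isHermitianSection_transition_iff.mp hτ v
    exact eq_of_transition_eq_of_mem_orthogonal τ_mem (mem_orthogonal v)
      (transition_τ.trans (transition_σ v).symm)

variable {f : hilb (N + n) n k}

lemma hilbMode_mem_orthogonal_ker_transition (hf : f ∈ (transition N n k).kerᗮ) (c : ℂ) (s : ℕ)
    (a b : Fin n) : hilbMode (N + n) n k c s a b f ∈ (transition N n k).kerᗮ := by
  rw [mem_orthogonal_ker_transition_iff] at hf ⊢
  intro w hw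
  rw [fockInner_hilbMode, hf _ (transition_hilbMode_eq_zero _ s b a hw)]

lemma coeff_shiftedT_mem_orthogonal_ker_transition (hf : f ∈ (transition N n k).kerᗮ)
    (a b : Fin n) (m : ℕ) :
    PowerSeries.coeff m (shiftedT (N + n) n k a b) f ∈ (transition N n k).kerᗮ := by
  cases m with
  | zero =>
    rw [coeff_zero_shiftedT]
    split_ifs
    exacts [hf, zero_mem _]
  | succ s =>
    rw [coeff_succ_shiftedT]
    exact hilbMode_mem_orthogonal_ker_transition hf _ s a b

lemma coeff_tildeT_mem_orthogonal_ker_transition (hf : f ∈ (transition N n k).kerᗮ)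
    (a b : Fin n) (m : ℕ) :
    PowerSeries.coeff m (tildeT (N + n) n k a b) f ∈ (transition N n k).kerᗮ := by
  rw [coeff_tildeT, LinearMap.sum_apply]
  exact Submodule.sum_mem _ fun x _ => Submodule.smul_mem _ _
    (coeff_shiftedT_mem_orthogonal_ker_transition hf a b x.1)

theorem section_comp_coeff_tildeT {σ : hilb N n k →ₗ[ℂ] hilb (N + n) n k}
    (hσ : IsHermitianSection (transition N n k) σ) (a b : Fin n) (m : ℕ) :
    σ ∘ₗ PowerSeries.coeff m (tildeT N n k a b) =
      PowerSeries.coeff m (tildeT (N + n) n k a b) ∘ₗ σ := by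
  rw [isHermitianSection_transition_iff] at hσ
  ext1 v
  refine eq_of_transition_eq_of_mem_orthogonal (hσ _).2
    (coeff_tildeT_mem_orthogonal_ker_transition (hσ v).2 a b m) ?_
  have := LinearMap.congr_fun (transition_comp_coeff_tildeT a b m) (σ v)
  simp only [LinearMap.comp_apply, (hσ _).1] at this ⊢
  exact this.symm

end HermitianSection

end MatrixModel

end

theorem mainTheorem5 (n k N : ℕ) (hn : 0 < n) (hk : 0 < k) :
    (∃! p : MatrixModel.hilb (N + n) n k →ₗ[ℂ] MatrixModel.hilb N n k,
      MatrixModel.IsTransitionMap N n k p) ∧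
    ∀ p : MatrixModel.hilb (N + n) n k →ₗ[ℂ] MatrixModel.hilb N n k,
      MatrixModel.IsTransitionMap N n k p →
      (∃! σ : MatrixModel.hilb N n k →ₗ[ℂ] MatrixModel.hilb (N + n) n k,
        MatrixModel.IsHermitianSection p σ) ∧
      (∀ (a b : Fin n) (m : ℕ),
        p ∘ₗ PowerSeries.coeff m (MatrixModel.tildeT (N + n) n k a b) =
          PowerSeries.coeff m (MatrixModel.tildeT N n k a b) ∘ₗ p) ∧
      ∀ σ : MatrixModel.hilb N n k →ₗ[ℂ] MatrixModel.hilb (N + n) n k,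
        MatrixModel.IsHermitianSection p σ →
        ∀ (a b : Fin n) (m : ℕ),
          σ ∘ₗ PowerSeries.coeff m (MatrixModel.tildeT N n k a b) =
            PowerSeries.coeff m (MatrixModel.tildeT (N + n) n k a b) ∘ₗ σ := by
  refine ⟨MatrixModel.existsUnique_isTransitionMap N n k, fun p hp => ?_⟩
  obtain rfl := hp.eq_transition
  exact ⟨MatrixModel.existsUnique_isHermitianSection_transition N n k,
    MatrixModel.transition_comp_coeff_tildeT,
    fun _ hσ => MatrixModel.section_comp_coeff_tildeT hσ⟩
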